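/- Let $R$ be a semiperfect basic ring which is left and right noetherian, and let $e \in R$ be an idempotent. All modules are right modules unless said otherwise. (Semiperfect: $R/\operatorname{rad} R$ is semisimple and idempotents lift modulo the Jacobson radical $\operatorname{rad} R$. Basic: $1 = \varepsilon_1 + \dots + \varepsilon_n$ with pairwise orthogonal primitive idempotents $\varepsilon_i$ such that the right modules $\varepsilon_i R$ are pairwise non-isomorphic.) For an idempotent $e' \in R$ put $\Gamma_{e'} := (1-e')R(1-e')$, and let $\langle 1-e\rangle$ be the two-sided ideal of $R$ generated by $1-e$. Let $S_e := eR/\operatorname{rad}(eR)$ and let $Y_e := \operatorname{Ext}_R^*(S_e,S_e) = \bigoplus_{k \ge 0} \operatorname{Ext}_R^k(S_e,S_e)$ be its Yoneda ring, with the Yoneda product as multiplication, where $fg$ means first $f$, then $g$. Suppose that $R/\langle 1-e\rangle$ is right artinian and that $\Gamma_{e'}$ has finite (right) global dimension for every idempotent $e' \in R$ with $e'e = ee' = e'$. Then $Y_e$ is a directed right artinian ring, that is, $Y_e$ is right artinian and there are pairwise orthogonal primitive idempotents $f_1, \dots, f_n \in Y_e$ with $f_1 + \dots + f_n = 1$ such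 that $f_i Y_e f_j = 0$ for all $1 \le i < j \le n$ and $f_i Y_e f_i$ is a skew field for all $1 \le i \le n$. Moreover, $Y_e$ has finite right global dimension and finite left global dimension. -/

import Mathlib

open CategoryTheory CategoryTheory.Abelian DirectSum

universe u

/-! ### Semiperfect basic rings

Right `A`-modules are modules over the opposite ring `Aᵐᵒᵖ`. -/

section RingNotions

/-- An idempotent is primitive if it is nonzero and is not a sum of two nonzero orthogonal
idempotents. -/
def IsPrimitiveIdempotent {A : Type u} [Ring A] (e : A) : Prop :=
  IsIdempotentElem e ∧ e ≠ 0 ∧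
    ∀ a b : A, IsIdempotentElem a → IsIdempotentElem b → a * b = 0 → b * a = 0 → a + b = e →
      a = 0 ∨ b = 0

/-- A ring is semiperfect if its quotient by the Jacobson radical is semisimple and idempotents
lift modulo the Jacobson radical. -/
def IsSemiperfectRing (A : Type u) [Ring A] : Prop :=
  IsSemisimpleRing (A ⧸ Ring.jacobson A) ∧
    ∀ x : A ⧸ Ring.jacobson A, IsIdempotentElem x →
      ∃ a : A, IsIdempotentElem a ∧ Ideal.Quotient.mk (Ring.jacobson A) a = x

/-- The right ideal `eA`, as a submodule of the right module `A`. -/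
def rightIdeal {A : Type u} [Ring A] (e : A) : Submodule Aᵐᵒᵖ A :=
  Submodule.span Aᵐᵒᵖ {e}

/-- A (semiperfect) ring is basic if `1` is a sum of pairwise orthogonal primitive idempotents
`ε₁, …, εₙ` such that the right modules `εᵢA` are pairwise non-isomorphic. -/
def IsBasicRing (A : Type u) [Ring A] : Prop :=
  ∃ (n : ℕ) (ε : Fin n → A), CompleteOrthogonalIdempotents ε ∧
    (∀ i, IsPrimitiveIdempotent (ε i)) ∧
    ∀ i j, i ≠ j → IsEmpty (rightIdeal (ε i) ≃ₗ[Aᵐᵒᵖ] rightIdeal (ε j))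

/-- The right global dimension of `A` is finite: the projective dimensions of the right
`A`-modules are bounded. -/
def FiniteRightGlobalDimension (A : Type u) [Ring A] : Prop :=
  ∃ n : ℕ, ∀ M : ModuleCat.{u} Aᵐᵒᵖ, HasProjectiveDimensionLE M n

/-- The left global dimension of `A` is finite: the projective dimensions of the left
`A`-modules are bounded. -/
def FiniteLeftGlobalDimension (A : Type u) [Ring A] : Prop :=
  ∃ n : ℕ, ∀ M : ModuleCat.{u} A, HasProjectiveDimensionLE M n

/-- A right artinian ring is directed if there are pairwise orthogonal primitive idempotents
`ε₁, …, εₙ` with sum `1` such that `εᵢAεⱼ = 0` for `i < j` and such that every `εᵢAεᵢ` is a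
skew field. -/
def IsDirectedRightArtinianRing (A : Type u) [Ring A] : Prop :=
  IsArtinianRing Aᵐᵒᵖ ∧
    ∃ (n : ℕ) (ε : Fin n → A) (hε : CompleteOrthogonalIdempotents ε),
      (∀ i, IsPrimitiveIdempotent (ε i)) ∧
      (∀ i j, i < j → ∀ a : A, ε i * a * ε j = 0) ∧
      ∀ i, Nontrivial (hε.idem i).Corner ∧ ∀ x : (hε.idem i).Corner, x ≠ 0 → IsUnit x

/-- The quotient of `A` by the two-sided ideal generated by `a`. -/
abbrev QuotientByElement {A : Type u} [Ring A] (a : A) : Type u :=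
  (TwoSidedIdeal.span {a}).ringCon.Quotient

/-- The idempotent subring `Γ_e = (1 - e)A(1 - e)` of `A`. -/
abbrev IdempotentSubring {A : Type u} [Ring A] {e : A} (he : IsIdempotentElem e) : Type u :=
  he.one_sub.Corner

/-- The semisimple right module `S_e = eA / rad(eA)`. -/
noncomputable def topModule {A : Type u} [Ring A] (e : A) : ModuleCat.{u} Aᵐᵒᵖ :=
  ModuleCat.of Aᵐᵒᵖ (rightIdeal e ⧸ Module.jacobson Aᵐᵒᵖ (rightIdeal e))

end RingNotions

/-! ### The Yoneda ring

The product of `α ∈ Ext^i(X, X)` and `β ∈ Ext^j(X, X)` is the Yoneda product `α ⬝ β`, where `α`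
is applied first. -/

section Yoneda

variable {C : Type*} [Category.{u} C] [Abelian C] [HasExt.{u} C] (X : C)

theorem yoneda_heq {X : C} {a b c d : ℕ} (α : Ext X X a) (β : Ext X X b) (h : a + b = c)
    (h' : a + b = d) : HEq (α.comp β h) (α.comp β h') := by
  subst h; subst h'; rfl

theorem yoneda_mul_assoc {X : C} {a b c : ℕ} (α : Ext X X a) (β : Ext X X b) (γ : Ext X X c) :
    HEq ((α.comp β (rfl : a + b = a + b)).comp γ (rfl : a + b + c = a + b + c))
      (α.comp (β.comp γ (rfl : b + c = b + c)) (rfl : a + (b + c) = a + (b + c))) := by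
  rw [Ext.comp_assoc α β γ rfl rfl rfl]
  exact yoneda_heq _ _ _ _

noncomputable instance yonedaGOne : GradedMonoid.GOne (fun n : ℕ => Ext X X n) where
  one := Ext.mk₀ (𝟙 X)

noncomputable instance yonedaGMul : GradedMonoid.GMul (fun n : ℕ => Ext X X n) where
  mul α β := α.comp β rfl

noncomputable instance yonedaGMonoid : GradedMonoid.GMonoid (fun n : ℕ => Ext X X n) where
  one_mul a := Sigma.ext (zero_add a.1) ((yoneda_heq (Ext.mk₀ (𝟙 X)) a.2 rfl (zero_add a.1)).trans
    (heq_of_eq (Ext.mk₀_id_comp a.2)))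
  mul_one a := Sigma.ext (add_zero a.1) ((yoneda_heq a.2 (Ext.mk₀ (𝟙 X)) rfl (add_zero a.1)).trans
    (heq_of_eq (Ext.comp_mk₀_id a.2)))
  mul_assoc a b c := Sigma.ext (add_assoc a.1 b.1 c.1) (yoneda_mul_assoc a.2 b.2 c.2)

noncomputable instance yonedaGRing : DirectSum.GRing (fun n : ℕ => Ext X X n) where
  __ := yonedaGMonoid X
  mul_zero {i j} α := Ext.comp_zero α X j (i + j) rfl
  zero_mul {i j} β := Ext.zero_comp X i β (i + j) rfl
  mul_add {i j} α β γ := Ext.comp_add α β γ (rfl : i + j = i + j)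
  add_mul {i j} α β γ := Ext.add_comp α β γ (rfl : i + j = i + j)
  natCast n := n • Ext.mk₀ (𝟙 X)
  natCast_zero := zero_smul ℕ _
  natCast_succ n := succ_nsmul (Ext.mk₀ (𝟙 X)) n
  intCast n := n • Ext.mk₀ (𝟙 X)
  intCast_ofNat n := natCast_zsmul _ n
  intCast_negSucc_ofNat n := negSucc_zsmul _ n

/-- The Yoneda ring `Ext^*(X, X) = ⨁ n, Ext^n(X, X)`. -/
abbrev YonedaRing : Type u := ⨁ n : ℕ, Ext X X n

end Yoneda

/-! Up to conjugation by a unit, `e` is a partial sum of primitive idempotents `ε i`, `i ∈ I`, with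
local right ideals that are pairwise non-isomorphic (`exists_isLocalFamily`). Hence S_e is the
direct sum of non-isomorphic simple modules S_i, and the projections f_i satisfy f_i Y f_j ≅
Ext^*(S_i, S_j). Draw an arrow i → j when Ext^k(S_i, S_j) ≠ 0 for some k > 0. The heart of the proof
is that this graph on I has no oriented cycle, loops included (`exists_directed_list`).

For I' ⊆ I put e' = ∑_{I'} ε_i and f = 1 - e'. A finite projective resolution of Mf over fRf lifts
to a complex over R of summands of powers of fR, starting in M. Its homology modules H_j are killed
by f, and they have finite length with factors S_i, i ∈ I', because R/⟨1-e⟩ is right artinian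
(`IsApproximated.exists_of_hasProjectiveDimensionLE`). Since Ext^*(fR, S_i) = 0 for i ∈ I', the
terms Ext^q(H_j, S_i) converge to Ext^{q+j}(M, S_i), as in a spectral sequence; here this is a
sequence of dimension shifts. For I' = ∅ one gets a genuine resolution, so the S_i have finite
projective dimension.

If there were a cycle, a minimal nonempty set I' without sinks would be a chordless cycle with
successor map s (`exists_minimal_sinkless`). Apply the above to the projective cover M = P_a. Let t
be the last index at which some S_p, p ∈ I', occurs in H_t, and let d + 1 be the top degree with
Ext(S_p, S_{s p}) ≠ 0. The class in Ext^{d+1}(H_t, S_{s p}) must cancel, which is possible only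
against a factor S_{s p} of some H_j with j ≥ t + d (`exists_occursAt_of_maximal`). Hence d = 0, and
all Ext^{≥2} between the S_i of the cycle vanish (`subsingleton_ext_of_two_le`). Then H_0 of P_a is
a projective cover of S_a relative to modules supported on I', its radical is again relatively
projective, and that radical maps onto the cover of S_{s a}. Lengths would strictly decrease around
the cycle (`not_nonempty_of_minimal`).

Topological sorting now makes Y_e triangular, with the skew fields End(S_i) on the diagonal. Such a
ring has finite global dimension on both sides (`hasProjectiveDimensionLT_of_triangular`). It is
right artinian because finitely many Ext groups are nonzero and each is artinian over End(S_e)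
(`isArtinian_ext`). -/

/-! ### Vanishing of `Ext` along short exact sequences of modules -/

section ExtVanishing

variable {A : Type u} [Ring A] {M₁ M₂ M₃ : ModuleCat.{u} A}

/-- The short complex attached to an exact pair of linear maps. -/
abbrev exactPair (f : M₁ →ₗ[A] M₂) (g : M₂ →ₗ[A] M₃) (h : Function.Exact f g) :
    ShortComplex (ModuleCat.{u} A) :=
  ShortComplex.mk (ModuleCat.ofHom f) (ModuleCat.ofHom g) (by ext x; exact h.apply_apply_eq_zero x)

theorem exactPair_shortExact {f : M₁ →ₗ[A] M₂} {g : M₂ →ₗ[A] M₃} (h : Function.Exact f g)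
    (hf : Function.Injective f) (hg : Function.Surjective g) : (exactPair f g h).ShortExact :=
  ModuleCat.shortComplex_shortExact _ h hf hg

variable {f : M₁ →ₗ[A] M₂} {g : M₂ →ₗ[A] M₃} (h : Function.Exact f g)
  (hf : Function.Injective f) (hg : Function.Surjective g) (Y : ModuleCat.{u} A)

include h hf hg

theorem subsingleton_ext_middle {k : ℕ} (h₁ : Subsingleton (Ext M₁ Y k))
    (h₃ : Subsingleton (Ext M₃ Y k)) : Subsingleton (Ext M₂ Y k) := by
  refine subsingleton_of_forall_eq 0 fun x => ?_
  obtain ⟨y, rfl⟩ := Ext.contravariant_sequence_exact₂ (exactPair_shortExact h hf hg) Y x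
    (Subsingleton.elim _ _)
  rw [Subsingleton.elim y 0, Ext.comp_zero]

theorem subsingleton_ext_right {k : ℕ} (h₁ : Subsingleton (Ext M₁ Y k))
    (h₂ : Subsingleton (Ext M₂ Y (k + 1))) : Subsingleton (Ext M₃ Y (k + 1)) := by
  refine subsingleton_of_forall_eq 0 fun x => ?_
  obtain ⟨y, rfl⟩ := Ext.contravariant_sequence_exact₃ (exactPair_shortExact h hf hg) Y x
    (Subsingleton.elim _ _) (add_comm 1 k)
  rw [Subsingleton.elim y 0, Ext.comp_zero]

theorem subsingleton_ext_left {k : ℕ} (h₂ : Subsingleton (Ext M₂ Y k))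
    (h₃ : Subsingleton (Ext M₃ Y (k + 1))) : Subsingleton (Ext M₁ Y k) := by
  refine subsingleton_of_forall_eq 0 fun x => ?_
  obtain ⟨y, rfl⟩ := Ext.contravariant_sequence_exact₁ (exactPair_shortExact h hf hg) Y x
    (add_comm 1 k) (Subsingleton.elim _ _)
  rw [Subsingleton.elim y 0, Ext.comp_zero]

end ExtVanishing

/-! ### Ext in degree zero, and for projective, zero and isomorphic modules -/

section ExtBasic

variable {A : Type u} [Ring A]

theorem subsingleton_ext_zero_iff {M Y : ModuleCat.{u} A} :
    Subsingleton (Ext M Y 0) ↔ ∀ φ : M →ₗ[A] Y, φ = 0 := by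
  rw [Ext.homEquiv₀.subsingleton_congr]
  constructor
  · intro h φ
    simpa using congrArg ModuleCat.Hom.hom (Subsingleton.elim (ModuleCat.ofHom φ) 0)
  · intro h
    refine subsingleton_of_forall_eq 0 fun φ => ?_
    ext1
    exact h φ.hom

theorem subsingleton_ext_succ_of_projective {P : ModuleCat.{u} A} (hP : Module.Projective A P)
    (Y : ModuleCat.{u} A) (k : ℕ) : Subsingleton (Ext P Y (k + 1)) := by
  have : Projective P := (IsProjective.iff_projective _ ).1 hP
  exact subsingleton_of_forall_eq 0 fun x => Ext.eq_zero_of_projective x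

theorem subsingleton_ext_of_subsingleton {M : ModuleCat.{u} A} (h : Subsingleton M)
    (Y : ModuleCat.{u} A) (k : ℕ) : Subsingleton (Ext M Y k) := by
  have hz : (𝟙 M) = 0 := by
    ext x
    exact Subsingleton.elim _ _
  refine subsingleton_of_forall_eq 0 fun x => ?_
  rw [← Ext.mk₀_id_comp x, hz, Ext.mk₀_zero, Ext.zero_comp]

theorem subsingleton_ext_congr {M N : ModuleCat.{u} A} (e : M ≃ₗ[A] N)
    (Y : ModuleCat.{u} A) (k : ℕ) : Subsingleton (Ext M Y k) ↔ Subsingleton (Ext N Y k) := by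
  suffices key : ∀ {M N : ModuleCat.{u} A} (_ : M ≃ₗ[A] N), Subsingleton (Ext M Y k) →
      Subsingleton (Ext N Y k) from ⟨key e, key e.symm⟩
  intro M N e h
  have hz : ModuleCat.ofHom e.symm.toLinearMap ≫ ModuleCat.ofHom e.toLinearMap = 𝟙 N := by
    ext x
    simp
  refine subsingleton_of_forall_eq 0 fun x => ?_
  rw [← Ext.mk₀_id_comp x, ← hz, ← Ext.mk₀_comp_mk₀_assoc,
    Subsingleton.elim ((Ext.mk₀ (ModuleCat.ofHom e.toLinearMap)).comp x (zero_add k)) 0,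
    Ext.comp_zero]

end ExtBasic

/-! ### Simple modules with local projective covers -/

/-- A family of pairwise non-isomorphic simple modules `S i` with local projective covers `P i`
generated by elements `p i` that are fixed by idempotents `ε i`. -/
structure LocalSystem (A : Type u) [Ring A] (ι : Type) where
  /-- the idempotents -/
  ε : ι → A
  /-- the projective covers -/
  P : ι → ModuleCat.{u} A
  /-- the simple modules -/
  S : ι → ModuleCat.{u} A
  /-- the generators -/
  p : ∀ i, P i
  /-- the covering maps -/
  q : ∀ i, P i →ₗ[A] S i
  idem : ∀ i, ε i * ε i = ε i
  smul_p : ∀ i, ε i • p i = p i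
  -- Since `p i` generates `P i`, this makes `P i` represent the functor M ↦ ε_i M.
  lift : ∀ (i) (M : ModuleCat.{u} A) (x : M), ε i • x = x → ∃ g : P i →ₗ[A] M, g (p i) = x
  -- Locality: the kernel of `q i` contains every proper submodule of `P i`.
  span_eq_top : ∀ i x, q i x ≠ 0 → Submodule.span A {x} = ⊤
  q_p_ne_zero : ∀ i, q i (p i) ≠ 0
  simple : ∀ i, IsSimpleModule A (S i)
  smul_eq_zero : ∀ i j, i ≠ j → ∀ x : S j, ε i • x = 0
  smul_eq_self : ∀ i (x : S i), ε i • x = x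

namespace LocalSystem

variable {A : Type u} [Ring A] {ι : Type} (L : LocalSystem A ι)

theorem span_p (i : ι) : Submodule.span A {L.p i} = ⊤ := L.span_eq_top i _ (L.q_p_ne_zero i)

theorem q_surjective (i : ι) : Function.Surjective (L.q i) := by
  have := L.simple i
  exact LinearMap.surjective_of_ne_zero fun h => L.q_p_ne_zero i (by rw [h]; rfl)

theorem hom_ext {i : ι} {M : Type u} [AddCommGroup M] [Module A M] {g h : L.P i →ₗ[A] M}
    (hgh : g (L.p i) = h (L.p i)) : g = h := by
  refine LinearMap.ext_on (L.span_p i) ?_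
  simpa using hgh

/-- A preimage of the generator under a surjection may be multiplied by `ε i`; it remains a preimage
and then defines a section. -/
theorem projective (i : ι) : Module.Projective A (L.P i) := by
  refine Module.Projective.of_lifting_property'' fun g hg => ?_
  obtain ⟨y, hy⟩ := hg (L.p i)
  obtain ⟨k, hk⟩ := L.lift i (ModuleCat.of A (L.P i →₀ A)) (L.ε i • y) (by rw [smul_smul, L.idem])
  refine ⟨k, L.hom_ext ?_⟩
  change g (k (L.p i)) = L.p i
  rw [hk, map_smul, hy, L.smul_p]

theorem finite (i : ι) : Module.Finite A (L.P i) :=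
  ⟨⟨{L.p i}, by simpa using L.span_p i⟩⟩

/-- A simple module on which `ε i` acts nontrivially is isomorphic to `S i`. -/
theorem exists_equiv {i : ι} {T : ModuleCat.{u} A} (hT : IsSimpleModule A T) {x : T}
    (hx : L.ε i • x ≠ 0) : ∃ φ : T ≃ₗ[A] L.S i, φ (L.ε i • x) = L.q i (L.p i) := by
  have := L.simple i
  obtain ⟨g, hg⟩ := L.lift i T (L.ε i • x) (by rw [smul_smul, L.idem])
  have hg0 : g ≠ 0 := fun h => hx (by rw [← hg, h]; rfl)
  have hgs : Function.Surjective g := LinearMap.surjective_of_ne_zero hg0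
  -- An element of `ker g` outside `ker (q i)` would generate `P i` and force `g = 0`. Since `ker g`
  -- is maximal, the two kernels agree.
  have hle : LinearMap.ker g ≤ LinearMap.ker (L.q i) := by
    intro y hy
    by_contra hy'
    refine hg0 (LinearMap.ext_on (L.span_eq_top i y hy') ?_)
    simpa using hy
  have hco : IsCoatom (LinearMap.ker g) := by
    rw [← isSimpleModule_iff_isCoatom]
    exact IsSimpleModule.congr (g.quotKerEquivOfSurjective hgs)
  have hne : LinearMap.ker (L.q i) ≠ ⊤ := by
    intro h
    exact L.q_p_ne_zero i (LinearMap.mem_ker.1 (h ▸ Submodule.mem_top))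
  have heq : LinearMap.ker g = LinearMap.ker (L.q i) :=
    (hco.le_iff.1 hle).resolve_left hne |>.symm
  refine ⟨(g.quotKerEquivOfSurjective hgs).symm ≪≫ₗ Submodule.quotEquivOfEq _ _ heq ≪≫ₗ
    (L.q i).quotKerEquivOfSurjective (L.q_surjective i), ?_⟩
  have hsymm : (g.quotKerEquivOfSurjective hgs).symm (L.ε i • x) =
      Submodule.Quotient.mk (L.p i) := by
    rw [LinearEquiv.symm_apply_eq, ← hg]
    rfl
  rw [LinearEquiv.trans_apply, LinearEquiv.trans_apply, hsymm]
  rfl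

theorem nonempty_equiv {i : ι} {T : ModuleCat.{u} A} (hT : IsSimpleModule A T) {x : T}
    (hx : L.ε i • x ≠ 0) : Nonempty (T ≃ₗ[A] L.S i) := by
  obtain ⟨φ, -⟩ := L.exists_equiv hT hx
  exact ⟨φ⟩

/-- `i` occurs in `M` if `S i` is a composition factor of `M`. -/
def Occurs (i : ι) (M : Type u) [AddCommGroup M] [Module A M] : Prop :=
  ∃ x : M, L.ε i • x ≠ 0

theorem Occurs.of_submodule {i : ι} {M : Type u} [AddCommGroup M] [Module A M]
    {N : Submodule A M} (h : L.Occurs i N) : L.Occurs i M := by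
  obtain ⟨x, hx⟩ := h
  exact ⟨x, fun h => hx (Subtype.ext h)⟩

theorem Occurs.of_surjective {i : ι} {M N : Type u} [AddCommGroup M] [Module A M]
    [AddCommGroup N] [Module A N] {g : M →ₗ[A] N} (hg : Function.Surjective g)
    (h : L.Occurs i N) : L.Occurs i M := by
  obtain ⟨x, hx⟩ := h
  obtain ⟨y, rfl⟩ := hg x
  exact ⟨y, fun h => hx (by rw [← map_smul, h, map_zero])⟩

/-- The functor M ↦ ε_i M is exact. -/
theorem occurs_submodule_or_quotient {i : ι} {M : Type u} [AddCommGroup M] [Module A M]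
    (N : Submodule A M) (h : L.Occurs i M) : L.Occurs i N ∨ L.Occurs i (M ⧸ N) := by
  obtain ⟨x, hx⟩ := h
  by_cases hN : L.ε i • x ∈ N
  · left
    refine ⟨⟨_, hN⟩, fun h => hx ?_⟩
    have := congrArg Subtype.val h
    simpa [smul_smul, L.idem] using this
  · right
    refine ⟨N.mkQ x, fun h => hN ?_⟩
    rwa [← map_smul, Submodule.mkQ_apply, Submodule.Quotient.mk_eq_zero] at h

theorem occurs_S (i : ι) : L.Occurs i (L.S i) :=
  ⟨L.q i (L.p i), by rw [← map_smul, L.smul_p]; exact L.q_p_ne_zero i⟩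

/-- A module is supported on a finite set of indices if the sum of the corresponding idempotents
acts as the identity. -/
def Supported (I : Finset ι) (M : Type u) [AddCommGroup M] [Module A M] : Prop :=
  ∀ x : M, (∑ i ∈ I, L.ε i) • x = x

variable {L}

theorem Supported.submodule {I : Finset ι} {M : Type u} [AddCommGroup M] [Module A M]
    (h : L.Supported I M) (N : Submodule A M) : L.Supported I N :=
  fun x => Subtype.ext (h x)

theorem Supported.of_surjective {I : Finset ι} {M N : Type u} [AddCommGroup M] [Module A M]
    [AddCommGroup N] [Module A N] (h : L.Supported I M) {g : M →ₗ[A] N}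
    (hg : Function.Surjective g) : L.Supported I N := by
  intro x
  obtain ⟨y, rfl⟩ := hg x
  rw [← map_smul, h]

theorem Supported.exists_equiv {I : Finset ι} {T : Type u} [AddCommGroup T] [Module A T]
    (h : L.Supported I T) [hT : IsSimpleModule A T] :
    ∃ i ∈ I, L.Occurs i T ∧ Nonempty (T ≃ₗ[A] L.S i) := by
  have := IsSimpleModule.nontrivial A T
  obtain ⟨x, hx⟩ := exists_ne (0 : T)
  have : ∃ i ∈ I, L.ε i • x ≠ 0 := by
    by_contra! hc
    apply hx
    rw [← h x, Finset.sum_smul]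
    exact Finset.sum_eq_zero hc
  obtain ⟨i, hi, hix⟩ := this
  exact ⟨i, hi, ⟨x, hix⟩, L.nonempty_equiv (T := ModuleCat.of A T) hT hix⟩

theorem supported_S {I : Finset ι} {i : ι} (hi : i ∈ I) : L.Supported I (L.S i) := by
  intro x
  rw [Finset.sum_smul, Finset.sum_eq_single_of_mem i hi, L.smul_eq_self]
  intro j _ hj
  exact L.smul_eq_zero j i hj x

/-- Dévissage along a composition series; only the simple modules that occur as factors have to be
tested. -/
theorem subsingleton_ext_of_isFiniteLength {I : Finset ι} {M : Type u} [AddCommGroup M]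
    [Module A M] (hM : IsFiniteLength A M) (hs : L.Supported I M) (Y : ModuleCat.{u} A) (k : ℕ)
    (h : ∀ i ∈ I, L.Occurs i M → Subsingleton (Ext (L.S i) Y k)) :
    Subsingleton (Ext (ModuleCat.of A M) Y k) := by
  induction hM with
  | of_subsingleton => exact subsingleton_ext_of_subsingleton (by assumption) Y k
  | @of_simple_quotient M _ _ N _ hN ih =>
    refine subsingleton_ext_middle (M₁ := ModuleCat.of A N) (M₃ := ModuleCat.of A (M ⧸ N))
      (LinearMap.exact_subtype_mkQ N) N.injective_subtype N.mkQ_surjective Y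
      (ih (hs.submodule N) fun i hi ho => h i hi (ho.of_submodule)) ?_
    obtain ⟨i, hi, ho, ⟨e⟩⟩ := (hs.of_surjective N.mkQ_surjective).exists_equiv
    exact (subsingleton_ext_congr (M := ModuleCat.of A (M ⧸ N)) e Y k).2
      (h i hi (ho.of_surjective L N.mkQ_surjective))

/-- The vanishing of Ext^{d+2} lets a class on a submodule extend to `M`. This allows descent along
a composition series until S_p is the top factor and does not occur below it; there the vanishing of
Ext^d below makes Ext^{d+1}(S_p, Y) embed. -/
theorem not_subsingleton_ext_of_occurs {I : Finset ι} {M : Type u} [AddCommGroup M]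
    [Module A M] (hM : IsFiniteLength A M) (hs : L.Supported I M) (Y : ModuleCat.{u} A) (d : ℕ)
    {p : ι} (hp : L.Occurs p M) (hpY : ¬ Subsingleton (Ext (L.S p) Y (d + 1)))
    (h₁ : ∀ i ∈ I, Subsingleton (Ext (L.S i) Y (d + 2)))
    (h₂ : ∀ i ∈ I, i ≠ p → L.Occurs i M → Subsingleton (Ext (L.S i) Y d)) :
    ¬ Subsingleton (Ext (ModuleCat.of A M) Y (d + 1)) := by
  induction hM with
  | of_subsingleton =>
    obtain ⟨x, hx⟩ := hp
    exact absurd (Subsingleton.elim _ _) hx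
  | @of_simple_quotient M _ _ N _ hN ih =>
    obtain ⟨i, hi, ho, ⟨e⟩⟩ := (hs.of_surjective N.mkQ_surjective).exists_equiv
    by_cases hpN : L.Occurs p N
    · intro hc
      refine ih (hs.submodule N) hpN (fun i hi hip ho => h₂ i hi hip ho.of_submodule) ?_
      exact subsingleton_ext_left (M₂ := ModuleCat.of A M) (M₃ := ModuleCat.of A (M ⧸ N))
        (LinearMap.exact_subtype_mkQ N) N.injective_subtype N.mkQ_surjective Y hc
        ((subsingleton_ext_congr (M := ModuleCat.of A (M ⧸ N)) e Y _).2 (h₁ i hi))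
    · intro hc
      obtain ⟨x, hx⟩ := (L.occurs_submodule_or_quotient N hp).resolve_left hpN
      obtain ⟨e'⟩ := L.nonempty_equiv (T := ModuleCat.of A (M ⧸ N)) inferInstance hx
      refine hpY ((subsingleton_ext_congr (M := ModuleCat.of A (M ⧸ N)) e' Y _).1 ?_)
      refine subsingleton_ext_right (M₁ := ModuleCat.of A N) (M₂ := ModuleCat.of A M)
        (LinearMap.exact_subtype_mkQ N) N.injective_subtype N.mkQ_surjective Y ?_ hc
      refine subsingleton_ext_of_isFiniteLength hN (hs.submodule N) Y d fun i hi ho => ?_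
      exact h₂ i hi (fun h => hpN (h ▸ ho)) ho.of_submodule

end LocalSystem

/-! ### Complexes of projective modules with controlled homology -/

/-- `IsApproximated g M [H₀, …, Hₙ]` states that there is a finite complex of projective modules
starting in `M`, whose terms in positive degrees have no nonzero maps to modules fixed by `g`, and
whose homology modules are `H₀, …, Hₙ`, which are finite and fixed by `g`. -/
inductive IsApproximated {A : Type u} [Ring A] (g : A) :
    ModuleCat.{u} A → List (ModuleCat.{u} A) → Prop
  | nil (M : ModuleCat.{u} A) (hM : Subsingleton M) : IsApproximated g M []
  | cons {M B H Z Q : ModuleCat.{u} A} {l : List (ModuleCat.{u} A)}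
      (i : B →ₗ[A] M) (π : M →ₗ[A] H) (hi : Function.Injective i) (hπ : Function.Surjective π)
      (hiπ : Function.Exact i π)
      (j : Z →ₗ[A] Q) (ρ : Q →ₗ[A] B) (hj : Function.Injective j) (hρ : Function.Surjective ρ)
      (hjρ : Function.Exact j ρ)
      (hQ : Module.Projective A Q)
      (hQ' : ∀ S : ModuleCat.{u} A, (∀ x : S, g • x = x) → ∀ φ : Q →ₗ[A] S, φ = 0)
      (hH : ∀ x : H, g • x = x) (hH' : Module.Finite A H)
      (hZ : IsApproximated g Z l) : IsApproximated g M (H :: l)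

namespace IsApproximated

variable {A : Type u} [Ring A] {g : A} {M : ModuleCat.{u} A} {l : List (ModuleCat.{u} A)}

/-- All Ext groups from `Q` to `Y` vanish, so Hom(B, Y) = 0 and Ext^{k+1}(B, Y) is controlled by
Ext^k(Z, Y). Thus Ext^q(H_j, Y) contributes only to Ext^{q+j}(M, Y). -/
theorem subsingleton_ext (h : IsApproximated g M l) {Y : ModuleCat.{u} A}
    (hY : ∀ x : Y, g • x = x) (c : ℕ)
    (hl : ∀ (j : ℕ) (H : ModuleCat.{u} A), l[j]? = some H → ∀ k, c ≤ k + j →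
      Subsingleton (Ext H Y k)) (k : ℕ) (hk : c ≤ k) : Subsingleton (Ext M Y k) := by
  induction h generalizing c k with
  | nil M hM => exact subsingleton_ext_of_subsingleton hM Y k
  | @cons M B H Z Q l i π hi hπ hiπ j ρ hj hρ hjρ hQ hQ' hH hH' hZ ih =>
    refine subsingleton_ext_middle hiπ hi hπ Y ?_ (hl 0 H rfl k hk)
    cases k with
    | zero =>
      refine subsingleton_ext_zero_iff.2 fun φ => ?_
      have := hQ' Y hY (φ ∘ₗ ρ)
      exact (LinearMap.cancel_right hρ).1 (by rw [this, LinearMap.zero_comp])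
    | succ k =>
      refine subsingleton_ext_right hjρ hj hρ Y ?_ (subsingleton_ext_succ_of_projective hQ Y k)
      -- Passing from `M` to `Z` lowers both the degree and the index bookkeeping by one; the
      -- truncation at `c = 0` is harmless.
      refine ih (c - 1) (fun j' H' hH' k' hk' => ?_) k (by lia)
      exact hl (j' + 1) H' hH' k' (by lia)

/-- The term Ext^{d+1}(H_t, Y) survives to Ext^{t+d+1}(M, Y): `hgt` removes what could kill it from
the later homology modules, and `hlt` removes the targets, of total degree t + d + 2, in the earlier
ones. -/
theorem not_subsingleton_ext (h : IsApproximated g M l) {Y : ModuleCat.{u} A}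
    (hY : ∀ x : Y, g • x = x) (d t : ℕ) {H : ModuleCat.{u} A} (ht : l[t]? = some H)
    (hH : ¬ Subsingleton (Ext H Y (d + 1)))
    (hgt : ∀ (j : ℕ) (H : ModuleCat.{u} A), t < j → l[j]? = some H → ∀ k, t + d ≤ k + j →
      Subsingleton (Ext H Y k))
    (hlt : ∀ (j : ℕ) (H : ModuleCat.{u} A), j < t → l[j]? = some H → ∀ k, t + d + 2 = k + j →
      Subsingleton (Ext H Y k)) : ¬ Subsingleton (Ext M Y (t + d + 1)) := by
  induction t generalizing M l with
  | zero =>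
    cases h with
    | nil => simp at ht
    | @cons M B H' Z Q l i π hi hπ hiπ j ρ hj hρ hjρ hQ hQ' hH1 hH2 hZ =>
      obtain rfl : H' = H := by simpa using ht
      intro hc
      refine hH (subsingleton_ext_right hiπ hi hπ Y ?_ (by simpa using hc))
      cases d with
      | zero =>
        refine subsingleton_ext_zero_iff.2 fun φ => ?_
        have := hQ' Y hY (φ ∘ₗ ρ)
        exact (LinearMap.cancel_right hρ).1 (by rw [this, LinearMap.zero_comp])
      | succ d =>
        refine subsingleton_ext_right hjρ hj hρ Y ?_ (subsingleton_ext_succ_of_projective hQ Y d)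
        refine hZ.subsingleton_ext hY d (fun j' H' hH' k' hk' => ?_) d le_rfl
        exact hgt (j' + 1) H' (by lia) hH' k' (by lia)
  | succ t ih =>
    cases h with
    | nil => simp at ht
    | @cons M B H' Z Q l i π hi hπ hiπ j ρ hj hρ hjρ hQ hQ' hH1 hH2 hZ =>
      intro hc
      refine ih hZ (by simpa using ht) (fun j H hj h k hk => hgt (j + 1) H (by lia) h k (by lia))
        (fun j H hj h k hk => hlt (j + 1) H (by lia) h k (by lia)) ?_
      have hQk : Subsingleton (Ext Q Y (t + d + 1)) :=
        subsingleton_ext_succ_of_projective hQ Y _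
      refine subsingleton_ext_left hjρ hj hρ Y hQk ?_
      refine subsingleton_ext_left hiπ hi hπ Y (k := t + d + 1 + 1) ?_ ?_
      · convert hc using 2
        lia
      · exact hlt 0 H' (by lia) rfl _ (by lia)

/-- If `g = 0`, the complex is a projective resolution. -/
theorem subsingleton_ext_of_length_lt (h : IsApproximated g M l) (hg : g = 0) (Y : ModuleCat.{u} A)
    (k : ℕ) (hk : l.length < k) : Subsingleton (Ext M Y k) := by
  induction h generalizing k with
  | nil M hM => exact subsingleton_ext_of_subsingleton hM Y k
  | @cons M B H Z Q l i π hi hπ hiπ j ρ hj hρ hjρ hQ hQ' hH hH' hZ ih =>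
    have hs : Subsingleton H := subsingleton_of_forall_eq 0 fun x => by rw [← hH x, hg, zero_smul]
    refine subsingleton_ext_middle hiπ hi hπ Y ?_ (subsingleton_ext_of_subsingleton hs Y k)
    obtain ⟨k, rfl⟩ := Nat.exists_eq_succ_of_ne_zero (n := k) (by lia)
    refine subsingleton_ext_right hjρ hj hρ Y ?_ (subsingleton_ext_succ_of_projective hQ Y k)
    refine ih k ?_
    simp only [List.length_cons] at hk
    lia

end IsApproximated

/-! ### Acyclicity of the extension quiver -/

namespace IsApproximated

variable {A : Type u} [Ring A] {g : A} {M : ModuleCat.{u} A} {l : List (ModuleCat.{u} A)}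

theorem finite_and_fixed (h : IsApproximated g M l) {j : ℕ} {H : ModuleCat.{u} A}
    (hj : l[j]? = some H) : Module.Finite A H ∧ ∀ x : H, g • x = x := by
  induction h generalizing j with
  | nil => simp at hj
  | cons i π hi hπ hiπ j' ρ hj' hρ hjρ hQ hQ' hH hH' hZ ih =>
    cases j with
    | zero =>
      obtain rfl : _ = H := by simpa using hj
      exact ⟨hH', hH⟩
    | succ j => exact ih (j := j) (by simpa using hj)

end IsApproximated

namespace LocalSystem

variable {A : Type u} [Ring A] {ι : Type} (L : LocalSystem A ι)

theorem subsingleton_ext_zero {i j : ι} (hij : i ≠ j) : Subsingleton (Ext (L.S i) (L.S j) 0) := by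
  refine subsingleton_ext_zero_iff.2 fun φ => LinearMap.ext fun x => ?_
  rw [← L.smul_eq_self i x, map_smul, L.smul_eq_zero i j hij, LinearMap.zero_apply]

/-- `i` occurs in the `j`-th module of a list. -/
def OccursAt (l : List (ModuleCat.{u} A)) (j : ℕ) (i : ι) : Prop :=
  ∃ H, l[j]? = some H ∧ L.Occurs i H

variable {L} {I : Finset ι} {s : ι → ι}

/-- By injectivity of `s`, only S_p has positive-degree extensions into S_{s p}, and only S_{s p}
has maps to it. If S_{s p} did not occur at an index ≥ t + d, nothing could cancel the nonzero
Ext^{d+1}(H_t, S_{s p}), although Ext^{t+d+1}(M, S_{s p}) = 0. -/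
theorem exists_occursAt_of_maximal
    (hfl : ∀ (M : ModuleCat.{u} A), Module.Finite A M → L.Supported I M → IsFiniteLength A M)
    (hs : ∀ c ∈ I, ∀ b ∈ I, ∀ k, ¬ Subsingleton (Ext (L.S c) (L.S b) (k + 1)) → b = s c)
    (hinj : Set.InjOn s I) {M : ModuleCat.{u} A} {l : List (ModuleCat.{u} A)}
    (hM : ∀ (Y : ModuleCat.{u} A) (k : ℕ), Subsingleton (Ext M Y (k + 1)))
    (hl : IsApproximated (∑ i ∈ I, L.ε i) M l) {p : ι} (hp : p ∈ I) (hsp : s p ∈ I) {d t : ℕ}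
    (hd : ¬ Subsingleton (Ext (L.S p) (L.S (s p)) (d + 1)))
    (hd' : ∀ k, d < k → Subsingleton (Ext (L.S p) (L.S (s p)) (k + 1)))
    (ht : L.OccursAt l t p) (ht' : ∀ j, t < j → ¬ L.OccursAt l j p) :
    ∃ j, t + d ≤ j ∧ L.OccursAt l j (s p) := by
  by_contra! hc
  obtain ⟨H, hH, hpH⟩ := ht
  have hS : ∀ i ∈ I, i ≠ p → ∀ k, Subsingleton (Ext (L.S i) (L.S (s p)) (k + 1)) := by
    intro i hi hip k
    by_contra hn
    exact hip (hinj hi hp (hs i hi _ hsp k hn).symm)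
  have hS' : ∀ i ∈ I, ∀ k, d < k → Subsingleton (Ext (L.S i) (L.S (s p)) (k + 1)) := by
    intro i hi k hk
    by_cases hip : i = p
    · subst hip
      exact hd' k hk
    · exact hS i hi hip k
  refine hl.not_subsingleton_ext (Y := L.S (s p)) (supported_S hsp) d t hH ?_ ?_ ?_ (hM _ _)
  · obtain ⟨hH₁, hH₂⟩ := hl.finite_and_fixed hH
    refine not_subsingleton_ext_of_occurs (hfl H hH₁ hH₂) hH₂ _ d hpH hd
      (fun i hi => hS' i hi (d + 1) (by lia)) fun i hi hip hio => ?_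
    cases d with
    | zero =>
      refine L.subsingleton_ext_zero fun h => hc t le_rfl ?_
      subst h
      exact ⟨H, hH, hio⟩
    | succ d => exact hS i hi hip d
  · intro j H' hj hH' k hk
    obtain ⟨hH₁, hH₂⟩ := hl.finite_and_fixed hH'
    refine subsingleton_ext_of_isFiniteLength (hfl H' hH₁ hH₂) hH₂ _ k fun i hi hio => ?_
    cases k with
    | zero =>
      refine L.subsingleton_ext_zero fun h => hc j (by lia) ?_
      subst h
      exact ⟨H', hH', hio⟩
    | succ k =>
      refine hS i hi (fun h => ht' j hj ?_) k
      subst h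
      exact ⟨H', hH', hio⟩
  · intro j H' hj hH' k hk
    obtain ⟨hH₁, hH₂⟩ := hl.finite_and_fixed hH'
    refine subsingleton_ext_of_isFiniteLength (hfl H' hH₁ hH₂) hH₂ _ k fun i hi hio => ?_
    obtain ⟨k, rfl⟩ := Nat.exists_eq_succ_of_ne_zero (n := k) (by lia)
    exact hS' i hi k (by lia)

theorem exists_greatest {p : ℕ → Prop} (h : ∃ n, p n) (hb : ∃ N, ∀ n, p n → n ≤ N) :
    ∃ n, p n ∧ ∀ k, n < k → ¬ p k := by
  classical
  obtain ⟨n, hn⟩ := h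
  obtain ⟨N, hN⟩ := hb
  exact ⟨Nat.findGreatest p N, Nat.findGreatest_spec (hN n hn) hn,
    fun k hk hpk => Nat.findGreatest_is_greatest hk (hN k hpk) hpk⟩

/-- At the last index `t` where a member of `I` occurs, an occurrence of `s p` at an index ≥ t + d
forces d = 0 and places `s p` at `t` again. The members occurring at `t` are therefore closed under
`s`, and by minimality they are all of `I`. -/
theorem subsingleton_ext_of_two_le
    (hfl : ∀ (M : ModuleCat.{u} A), Module.Finite A M → L.Supported I M → IsFiniteLength A M)
    (hs : ∀ c ∈ I, ∀ b ∈ I, ∀ k, ¬ Subsingleton (Ext (L.S c) (L.S b) (k + 1)) → b = s c)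
    (hinj : Set.InjOn s I) (hmaps : ∀ c ∈ I, s c ∈ I)
    (hne : ∀ c ∈ I, ∃ k, ¬ Subsingleton (Ext (L.S c) (L.S (s c)) (k + 1)))
    (hbd : ∀ c ∈ I, ∃ N, ∀ k, N < k → Subsingleton (Ext (L.S c) (L.S (s c)) (k + 1)))
    (hmin : ∀ T ⊆ I, T.Nonempty → (∀ c ∈ T, s c ∈ T) → T = I)
    {M : ModuleCat.{u} A} {l : List (ModuleCat.{u} A)}
    (hM : ∀ (Y : ModuleCat.{u} A) (k : ℕ), Subsingleton (Ext M Y (k + 1)))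
    (hl : IsApproximated (∑ i ∈ I, L.ε i) M l) (hocc : ∃ j, ∃ p ∈ I, L.OccursAt l j p)
    {c b : ι} (hc : c ∈ I) (hb : b ∈ I) (k : ℕ) :
    Subsingleton (Ext (L.S c) (L.S b) (k + 2)) := by
  classical
  obtain ⟨t, ⟨a, ha, hat⟩, htmax⟩ := exists_greatest hocc
    ⟨l.length, fun n ⟨p, _, H, hH, _⟩ => by
      by_contra hn
      rw [List.getElem?_eq_none (by lia)] at hH
      cases hH⟩
  have key : ∀ p ∈ I, L.OccursAt l t p → L.OccursAt l t (s p) ∧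
      ∀ k, Subsingleton (Ext (L.S p) (L.S (s p)) (k + 2)) := by
    intro p hp hpt
    obtain ⟨N, hN⟩ := hbd p hp
    obtain ⟨d, hd, hd'⟩ := exists_greatest (hne p hp)
      ⟨N, fun n hn => by
        by_contra hn'
        exact hn (hN n (by lia))⟩
    obtain ⟨j, hj, hjo⟩ := exists_occursAt_of_maximal hfl hs hinj hM hl hp (hmaps p hp) hd
      (fun k hk => not_not.1 (hd' k hk)) hpt
      (fun j hj hjo => htmax j hj ⟨p, hp, hjo⟩)
    have hjt : j ≤ t := by
      by_contra hjt
      exact htmax j (by lia) ⟨s p, hmaps p hp, hjo⟩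
    obtain rfl : j = t := by lia
    exact ⟨hjo, fun k => not_not.1 (hd' (k + 1) (by lia))⟩
  have hT := hmin (I.filter fun p => L.OccursAt l t p) (Finset.filter_subset _ _)
    ⟨a, Finset.mem_filter.2 ⟨ha, hat⟩⟩ fun c hc => by
      rw [Finset.mem_filter] at hc ⊢
      exact ⟨hmaps c hc.1, (key c hc.1 hc.2).1⟩
  by_contra hn
  obtain rfl := hs c hc b hb _ hn
  rw [← hT, Finset.mem_filter] at hc
  exact hn ((key c hc.1 hc.2).2 k)

/-- The degree zero homology of an approximation of `P a`. -/
theorem exists_relative_projective {a : ι} (ha : a ∈ I) {l : List (ModuleCat.{u} A)}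
    (hl : IsApproximated (∑ i ∈ I, L.ε i) (L.P a) l) :
    ∃ (H : ModuleCat.{u} A) (r : H →ₗ[A] L.S a), l[0]? = some H ∧ Function.Surjective r ∧
      (∀ x, r x ≠ 0 → Submodule.span A {x} = ⊤) ∧
      ∀ b ∈ I, Subsingleton (Ext H (L.S b) 1) := by
  cases hl with
  | nil _ h => exact absurd (by rw [Subsingleton.elim (L.p a) 0, map_zero]) (L.q_p_ne_zero a)
  | @cons _ B H Z Q l i π hi hπ hiπ j ρ hj hρ hjρ hQ hQ' hH hH' hZ =>
    -- `Q` has no maps to S_b and covers `B`. So `q a` factors through `H`, which inherits locality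
    -- from `P a`, and Ext^1(H, S_b) is squeezed between Hom(B, S_b) = 0 and Ext^1(P a, S_b) = 0.
    have hB : ∀ b ∈ I, ∀ φ : B →ₗ[A] L.S b, φ = 0 := by
      intro b hb φ
      have := hQ' (L.S b) (supported_S hb) (φ ∘ₗ ρ)
      exact (LinearMap.cancel_right hρ).1 (by rw [this, LinearMap.zero_comp])
    have hle : LinearMap.ker π ≤ LinearMap.ker (L.q a) := by
      intro x hx
      obtain ⟨y, rfl⟩ := (hiπ x).1 hx
      exact LinearMap.congr_fun (hB a ha (L.q a ∘ₗ i)) y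
    obtain ⟨r, hr⟩ : ∃ r : H →ₗ[A] L.S a, r ∘ₗ π = L.q a := by
      refine ⟨(LinearMap.ker π).liftQ (L.q a) hle ∘ₗ
        (π.quotKerEquivOfSurjective hπ).symm.toLinearMap, LinearMap.ext fun x => ?_⟩
      have : (π.quotKerEquivOfSurjective hπ).symm (π x) = (LinearMap.ker π).mkQ x := by
        rw [LinearEquiv.symm_apply_eq]
        rfl
      simp [this]
    have hr' : ∀ x, r (π x) = L.q a x := fun x => LinearMap.congr_fun hr x
    refine ⟨H, r, rfl, ?_, ?_, ?_⟩
    · refine Function.Surjective.of_comp (g := π) ?_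
      rw [← LinearMap.coe_comp, hr]
      exact L.q_surjective a
    · intro x hx
      obtain ⟨y, rfl⟩ := hπ x
      rw [hr'] at hx
      have := L.span_eq_top a y hx
      rw [← Set.image_singleton, Submodule.span_image, this, Submodule.map_top,
        LinearMap.range_eq_top.2 hπ]
    · intro b hb
      exact subsingleton_ext_right hiπ hi hπ _ (subsingleton_ext_zero_iff.2 (hB b hb))
        (subsingleton_ext_succ_of_projective (L.projective a) _ 0)

/-- Dévissage in the second variable: projectivity relative to the supported modules of finite
length can be tested on the simple ones. -/
theorem subsingleton_ext_one_of_isFiniteLength {K : ModuleCat.{u} A} {M : Type u} [AddCommGroup M]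
    [Module A M] (hM : IsFiniteLength A M) (hs : L.Supported I M)
    (hK : ∀ b ∈ I, Subsingleton (Ext K (L.S b) 1)) :
    Subsingleton (Ext K (ModuleCat.of A M) 1) := by
  induction hM with
  | @of_subsingleton M _ _ _ =>
    have hz : (𝟙 (ModuleCat.of A M)) = 0 := by
      ext x
      exact Subsingleton.elim _ _
    refine subsingleton_of_forall_eq 0 fun x => ?_
    rw [← Ext.comp_mk₀_id x, hz, Ext.mk₀_zero, Ext.comp_zero]
  | @of_simple_quotient M _ _ N _ hN ih =>
    obtain ⟨i, hi, -, ⟨e⟩⟩ := (hs.of_surjective N.mkQ_surjective).exists_equiv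
    have hS := exactPair_shortExact (M₁ := ModuleCat.of A N) (M₂ := ModuleCat.of A M)
      (M₃ := L.S i) (f := N.subtype) (g := e.toLinearMap ∘ₗ N.mkQ)
      (fun x => by simp) N.injective_subtype (e.surjective.comp N.mkQ_surjective)
    refine subsingleton_of_forall_eq 0 fun x => ?_
    have := hK i hi
    have := ih (hs.submodule N)
    obtain ⟨y, rfl⟩ := Ext.covariant_sequence_exact₂ K hS x (Subsingleton.elim _ _)
    rw [Subsingleton.elim y 0, Ext.zero_comp]

/-- A set of indices without sink that is minimal with this property has to be empty. -/
theorem not_nonempty_of_minimal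
    (hfl : ∀ (M : ModuleCat.{u} A), Module.Finite A M → L.Supported I M → IsFiniteLength A M)
    (hs : ∀ c ∈ I, ∀ b ∈ I, ∀ k, ¬ Subsingleton (Ext (L.S c) (L.S b) (k + 1)) → b = s c)
    (hinj : Set.InjOn s I) (hmaps : ∀ c ∈ I, s c ∈ I)
    (hne : ∀ c ∈ I, ∃ k, ¬ Subsingleton (Ext (L.S c) (L.S (s c)) (k + 1)))
    (hbd : ∀ c ∈ I, ∃ N, ∀ k, N < k → Subsingleton (Ext (L.S c) (L.S (s c)) (k + 1)))
    (hmin : ∀ T ⊆ I, T.Nonempty → (∀ c ∈ T, s c ∈ T) → T = I)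
    (happ : ∀ a ∈ I, ∃ l, IsApproximated (∑ i ∈ I, L.ε i) (L.P a) l) : ¬ I.Nonempty := by
  classical
  intro hI
  choose! l hl using happ
  choose! M r hM hr hspan hext using
    fun a (ha : a ∈ I) => exists_relative_projective ha (hl a ha)
  -- The approximation of `P c` has a nontrivial occurrence: `c` occurs in degree zero because `M c`
  -- maps onto S_c.
  have h2 : ∀ c ∈ I, ∀ b ∈ I, ∀ k, Subsingleton (Ext (L.S c) (L.S b) (k + 2)) := by
    intro c hc b hb k
    refine subsingleton_ext_of_two_le hfl hs hinj hmaps hne hbd hmin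
      (fun Y k => subsingleton_ext_succ_of_projective (L.projective c) Y k) (hl c hc)
      ⟨0, c, hc, M c, hM c hc, (L.occurs_S c).of_surjective L (hr c hc)⟩ hc hb k
  have hlen : ∀ a ∈ I, IsFiniteLength A (M a) := fun a ha =>
    hfl _ ((hl a ha).finite_and_fixed (hM a ha)).1 ((hl a ha).finite_and_fixed (hM a ha)).2
  -- The contradiction will be that `M (s a)` is strictly shorter than the shortest `M a`.
  obtain ⟨a, ha, hmin'⟩ := I.exists_min_image (fun a => Module.length A (M a)) hI
  have hsa := hmaps a ha
  let K := LinearMap.ker (r a)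
  have hKex : Function.Exact K.subtype (r a) := LinearMap.exact_subtype_ker_map (r a)
  -- The radical `K` of `M a` is again relatively projective, since Ext^2(S_a, S_b) = 0.
  have hK1 : ∀ b ∈ I, Subsingleton (Ext (ModuleCat.of A K) (L.S b) 1) := fun b hb =>
    subsingleton_ext_left (M₁ := ModuleCat.of A K) hKex K.injective_subtype (hr a ha) _
      (hext a ha b hb) (h2 a ha b hb 0)
  -- If Hom(K, S_{s a}) were zero, Ext^1(S_a, S_{s a}) would vanish, and with it every positive Ext
  -- along the arrow from `a` to `s a`.
  have hK0 : ¬ Subsingleton (Ext (ModuleCat.of A K) (L.S (s a)) 0) := by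
    intro hc
    obtain ⟨k, hk⟩ := hne a ha
    cases k with
    | zero =>
      exact hk (subsingleton_ext_right (M₁ := ModuleCat.of A K) hKex K.injective_subtype (hr a ha) _
        hc (hext a ha _ hsa))
    | succ k => exact hk (h2 a ha _ hsa k)
  rw [subsingleton_ext_zero_iff] at hK0
  push Not at hK0
  obtain ⟨φ, hφ⟩ := hK0
  let K' := LinearMap.ker (r (s a))
  have hS := exactPair_shortExact (M₁ := ModuleCat.of A K') (M₂ := M (s a)) (M₃ := L.S (s a))
    (LinearMap.exact_subtype_ker_map (r (s a))) K'.injective_subtype (hr _ hsa)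
  -- This is the obstruction to lifting `φ : K → S_{s a}` along the cover `M (s a) → S_{s a}`.
  have hK' : Subsingleton (Ext (ModuleCat.of A K) (ModuleCat.of A K') 1) := by
    have hMs := ((hl _ hsa).finite_and_fixed (hM _ hsa)).2
    refine subsingleton_ext_one_of_isFiniteLength ((hlen _ hsa).of_injective K'.injective_subtype)
      (Supported.submodule hMs K') hK1
  obtain ⟨y, hy⟩ := Ext.covariant_sequence_exact₃ (ModuleCat.of A K) hS
    (Ext.mk₀ (ModuleCat.ofHom φ)) (zero_add 1) (Subsingleton.elim _ _)
  obtain ⟨ψ, rfl⟩ := (Ext.mk₀_bijective _ _).2 y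
  rw [Ext.mk₀_comp_mk₀] at hy
  have hψ : ∀ x, r (s a) (ψ.hom x) = φ x := fun x =>
    congrArg (fun f => f.hom x) ((Ext.mk₀_bijective _ _).1 hy)
  -- The image of the lift contains an element outside the kernel of the cover, and such an element
  -- generates the local module `M (s a)`.
  have hsurj : Function.Surjective ψ.hom := by
    obtain ⟨x, hx⟩ : ∃ x, φ x ≠ 0 := by
      by_contra! h
      exact hφ (LinearMap.ext h)
    rw [← hψ] at hx
    rw [← LinearMap.range_eq_top, eq_top_iff, ← hspan _ hsa _ hx, Submodule.span_singleton_le_iff_mem]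
    exact ⟨x, rfl⟩
  have h₁ : Module.length A (M (s a)) ≤ Module.length A K := Module.length_le_of_surjective _ hsurj
  have h₂ := Module.length_eq_add_of_exact K.subtype (r a) K.injective_subtype (hr a ha) hKex
  have h₃ := hmin' _ hsa
  have h₄ : Module.length A (L.S a) = 1 := by
    have := L.simple a
    exact Module.length_eq_one A _
  have h₅ : Module.length A (M a) ≠ ⊤ := Module.length_ne_top_iff.2 (hlen a ha)
  rw [h₄] at h₂
  have h₆ : Module.length A K < Module.length A (M a) := by
    rw [h₂]
    exact ENat.lt_add_one_iff (fun h => h₅ (by rw [h₂, h]; rfl)) |>.2 le_rfl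
  exact absurd (h₃.trans h₁) (not_le.2 h₆)

end LocalSystem

/-! ### Relations on finite sets without sinks -/

section Sinks

variable {ι : Type*} [DecidableEq ι] {r : ι → ι → Prop} {I : Finset ι}

/-- A minimal nonempty finite set without sinks is a cycle without chords. -/
theorem exists_minimal_sinkless (hI : I.Nonempty) (hr : ∀ i ∈ I, ∃ j ∈ I, r i j) :
    ∃ I' ⊆ I, ∃ s : ι → ι, I'.Nonempty ∧ (∀ c ∈ I', ∀ b ∈ I', r c b → b = s c) ∧
      (∀ c ∈ I', s c ∈ I' ∧ r c (s c)) ∧ Set.InjOn s I' ∧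
      ∀ T ⊆ I', T.Nonempty → (∀ c ∈ T, s c ∈ T) → T = I' := by
  obtain ⟨I', hI'I, hmin⟩ := exists_minimal_le_of_wellFoundedLT
    (fun T : Finset ι => T.Nonempty ∧ ∀ i ∈ T, ∃ j ∈ T, r i j) I ⟨hI, hr⟩
  obtain ⟨hne, hI'⟩ := hmin.prop
  choose! s hs using hI'
  -- A nonempty subset closed under a choice of successors has no sink, so by minimality it is
  -- everything. Applied to the image, this makes every choice of successors surjective.
  have hclosed : ∀ s' : ι → ι, (∀ c ∈ I', s' c ∈ I' ∧ r c (s' c)) →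
      ∀ T ⊆ I', T.Nonempty → (∀ c ∈ T, s' c ∈ T) → T = I' := fun s' hs' T hT hTn hTs =>
    le_antisymm hT (hmin.le_of_le ⟨hTn, fun i hi => ⟨s' i, hTs i hi, (hs' i (hT hi)).2⟩⟩ hT)
  have himage : ∀ s' : ι → ι, (∀ c ∈ I', s' c ∈ I' ∧ r c (s' c)) → I'.image s' = I' := by
    intro s' hs'
    have hsub : I'.image s' ⊆ I' := Finset.image_subset_iff.2 fun c hc => (hs' c hc).1
    exact hclosed s' hs' _ hsub (hne.image _) fun c hc => Finset.mem_image_of_mem _ (hsub hc)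
  have hinj : Set.InjOn s I' := Finset.card_image_iff.1 (by rw [himage s hs])
  refine ⟨I', hI'I, s, hne, fun c hc b hb hcb => ?_, hs, hinj, hclosed s hs⟩
  by_contra hbs
  -- A chord from `c` to `b` permits rerouting `s` at `c`. The rerouted map is still surjective, so
  -- `s c` is also the successor of some `d ≠ c`, against injectivity of `s`.
  have hs' : ∀ d ∈ I', Function.update s c b d ∈ I' ∧ r d (Function.update s c b d) := by
    intro d hd
    by_cases hdc : d = c
    · subst hdc
      simpa using ⟨hb, hcb⟩
    · simpa [hdc] using hs d hd
  have := himage _ hs'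
  have hmem : s c ∈ I'.image (Function.update s c b) := by
    rw [this]
    exact (hs c hc).1
  obtain ⟨d, hd, hdc⟩ := Finset.mem_image.1 hmem
  by_cases h : d = c
  · subst h
    rw [Function.update_self] at hdc
    exact hbs hdc
  · rw [Function.update_of_ne h] at hdc
    exact h (hinj hd hc hdc)

/-- Topological sorting. -/
theorem exists_sorted_list (h : ∀ T ⊆ I, T.Nonempty → ∃ i ∈ T, ∀ j ∈ T, ¬ r i j) :
    ∃ l : List ι, l.Nodup ∧ l.toFinset = I ∧ l.Pairwise fun a b => ¬ r a b := by
  induction I using Finset.strongInduction with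
  | H I ih =>
    by_cases hI : I.Nonempty
    · obtain ⟨i, hi, hij⟩ := h I subset_rfl hI
      obtain ⟨l, h₁, h₂, h₃⟩ := ih (I.erase i) (Finset.erase_ssubset hi)
        fun T hT => h T (hT.trans (Finset.erase_subset _ _))
      have hmem : ∀ a, a ∈ l ↔ a ≠ i ∧ a ∈ I := by
        intro a
        rw [← List.mem_toFinset, h₂, Finset.mem_erase]
      refine ⟨i :: l, ?_, ?_, ?_⟩
      · exact List.nodup_cons.2 ⟨fun hl => ((hmem i).1 hl).1 rfl, h₁⟩
      · rw [List.toFinset_cons, h₂, Finset.insert_erase hi]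
      · exact List.pairwise_cons.2 ⟨fun b hb => hij b ((hmem b).1 hb).2, h₃⟩
    · refine ⟨[], List.nodup_nil, ?_, List.Pairwise.nil⟩
      rw [Finset.not_nonempty_iff_eq_empty.1 hI, List.toFinset_nil]

end Sinks

/-! ### Ordering the simple modules by their extensions -/

namespace LocalSystem

variable {A : Type u} [Ring A] {ι : Type} [DecidableEq ι] {L : LocalSystem A ι} {I : Finset ι}

/-- Every nonempty subset has a sink, which is what topological sorting needs; one-element subsets
give the absence of loops. -/
theorem exists_directed_list
    (hfl : ∀ I' ⊆ I, ∀ (M : ModuleCat.{u} A), Module.Finite A M → L.Supported I' M →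
      IsFiniteLength A M)
    (hbd : ∀ c ∈ I, ∃ N, ∀ (Y : ModuleCat.{u} A) (k : ℕ), N < k → Subsingleton (Ext (L.S c) Y k))
    (happ : ∀ I' ⊆ I, ∀ a ∈ I', ∃ l, IsApproximated (∑ i ∈ I', L.ε i) (L.P a) l) :
    (∃ l : List ι, l.Nodup ∧ l.toFinset = I ∧
      l.Pairwise fun a b => ∀ k, Subsingleton (Ext (L.S a) (L.S b) k)) ∧
    ∀ a ∈ I, ∀ k, Subsingleton (Ext (L.S a) (L.S a) (k + 1)) := by
  have hsink : ∀ T ⊆ I, T.Nonempty → ∃ i ∈ T, ∀ j ∈ T,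
      ¬ ∃ k, ¬ Subsingleton (Ext (L.S i) (L.S j) (k + 1)) := by
    intro T hT hTn
    by_contra! hc
    obtain ⟨I', hI', s, hne, h₁, h₂, h₃, h₄⟩ := exists_minimal_sinkless
      (r := fun i j => ∃ k, ¬ Subsingleton (Ext (L.S i) (L.S j) (k + 1))) hTn
      (by simpa only [not_subsingleton_iff_nontrivial] using hc)
    refine not_nonempty_of_minimal (hfl I' (hI'.trans hT)) (fun c hc b hb k hk => h₁ c hc b hb ⟨k, hk⟩)
      h₃ (fun c hc => (h₂ c hc).1) (fun c hc => (h₂ c hc).2) (fun c hc => ?_) h₄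
      (happ I' (hI'.trans hT)) hne
    obtain ⟨N, hN⟩ := hbd c (hT (hI' hc))
    exact ⟨N, fun k hk => hN _ _ (by lia)⟩
  constructor
  · obtain ⟨l, h₁, h₂, h₃⟩ := exists_sorted_list hsink
    refine ⟨l, h₁, h₂, ?_⟩
    have h₁' : l.Pairwise (· ≠ ·) := h₁
    refine (h₃.and h₁').imp fun {a b} hab k => ?_
    cases k with
    | zero => exact L.subsingleton_ext_zero hab.2
    | succ k =>
      by_contra hk
      exact hab.1 ⟨k, hk⟩
  · intro a ha k
    obtain ⟨i, hi, hij⟩ := hsink {a} (Finset.singleton_subset_iff.2 ha) (Finset.singleton_nonempty a)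
    obtain rfl := Finset.mem_singleton.1 hi
    by_contra hk
    exact hij i hi ⟨k, hk⟩

end LocalSystem

section

/-! ### The part of a right module fixed by an idempotent -/

open MulOpposite in
/-- The additive group `Mf` of elements of a right module that are fixed by `f`. -/
def fixedAddSubgroup {R : Type u} [Ring R] (f : R) (M : Type u) [AddCommGroup M] [Module Rᵐᵒᵖ M] :
    AddSubgroup M where
  carrier := {x | op f • x = x}
  add_mem' {x y} hx hy := by
    change op f • (x + y) = x + y
    rw [smul_add, hx, hy]
  zero_mem' := smul_zero _
  neg_mem' {x} hx := by
    change op f • (-x) = -x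
    rw [smul_neg, hx]

/-- The right `fRf`-module `Mf`. -/
def FixedPart {R : Type u} [Ring R] {f : R} (_ : IsIdempotentElem f) (M : Type u) [AddCommGroup M]
    [Module Rᵐᵒᵖ M] : Type u :=
  fixedAddSubgroup f M

namespace FixedPart

open MulOpposite

variable {R : Type u} [Ring R] {f : R} (hf : IsIdempotentElem f)

instance (M : Type u) [AddCommGroup M] [Module Rᵐᵒᵖ M] : AddCommGroup (FixedPart hf M) :=
  inferInstanceAs (AddCommGroup (fixedAddSubgroup f M))

theorem mul_corner {f : R} {hf : IsIdempotentElem f} (c : hf.Corner) : c.1 * f = c.1 :=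
  ((Subsemigroup.mem_corner_iff hf).1 c.2).2

section

variable {M N : Type u} [AddCommGroup M] [Module Rᵐᵒᵖ M] [AddCommGroup N] [Module Rᵐᵒᵖ N]

theorem ext {x y : FixedPart hf M} (h : x.1 = y.1) : x = y := Subtype.ext h

instance : Module hf.Cornerᵐᵒᵖ (FixedPart hf M) where
  smul c x := ⟨op (unop c).1 • x.1, by
    change op f • op (unop c).1 • x.1 = op (unop c).1 • x.1
    rw [smul_smul, ← op_mul, mul_corner]⟩
  one_smul x := Subtype.ext x.2
  mul_smul a b x := Subtype.ext (by
    change op ((unop b).1 * (unop a).1) • x.1 = op (unop a).1 • op (unop b).1 • x.1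
    rw [smul_smul, ← op_mul])
  smul_zero a := Subtype.ext (smul_zero _)
  smul_add a x y := Subtype.ext (smul_add _ _ _)
  add_smul a b x := Subtype.ext (by
    exact add_smul (op (unop a).1) (op (unop b).1) x.1)
  zero_smul x := Subtype.ext (by
    change op (0 : R) • x.1 = 0
    rw [op_zero, zero_smul])

theorem coe_sum {κ : Type*} (s : Finset κ) (x : κ → FixedPart hf M) :
    (∑ k ∈ s, x k).1 = ∑ k ∈ s, (x k).1 :=
  map_sum (fixedAddSubgroup f M).subtype x s

/-- Functoriality of the fixed part. -/
def map (g : M →ₗ[Rᵐᵒᵖ] N) : FixedPart hf M →ₗ[hf.Cornerᵐᵒᵖ] FixedPart hf N where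
  toFun x := ⟨g x.1, by
    change op f • g x.1 = g x.1
    rw [← map_smul, x.2]⟩
  map_add' x y := Subtype.ext (map_add g _ _)
  map_smul' c x := Subtype.ext (map_smul g _ _)

/-- The element `xf` of `Mf`. -/
def proj (x : M) : FixedPart hf M := ⟨op f • x, by
  change op f • op f • x = op f • x
  rw [smul_smul, ← op_mul, hf.eq]⟩

end

/-- The right module `(fR)ʳ`. -/
def Cover (f : R) (r : ℕ) : Type u := Fin r → rightIdeal f

instance (f : R) (r : ℕ) : AddCommGroup (Cover f r) :=
  inferInstanceAs (AddCommGroup (Fin r → rightIdeal f))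

instance (f : R) (r : ℕ) : Module Rᵐᵒᵖ (Cover f r) :=
  inferInstanceAs (Module Rᵐᵒᵖ (Fin r → rightIdeal f))

instance (f : R) (r : ℕ) : Module.Finite Rᵐᵒᵖ (Cover f r) :=
  have : Module.Finite Rᵐᵒᵖ (rightIdeal f) := Module.Finite.span_singleton Rᵐᵒᵖ f
  inferInstanceAs (Module.Finite Rᵐᵒᵖ (Fin r → rightIdeal f))

variable {r : ℕ}

theorem mem_rightIdeal_iff {f : R} (hf : IsIdempotentElem f) {x : R} :
    x ∈ rightIdeal f ↔ f * x = x := by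
  rw [rightIdeal, Submodule.mem_span_singleton]
  constructor
  · rintro ⟨a, rfl⟩
    rw [← op_unop a, op_smul_eq_mul, ← mul_assoc, hf.eq]
  · intro h
    exact ⟨op x, by rw [op_smul_eq_mul, h]⟩

/-- The canonical generators of `(fR)ʳ`. -/
def gen (r : ℕ) (i : Fin r) : FixedPart hf (Cover f r) :=
  ⟨Pi.single i ⟨f, (mem_rightIdeal_iff hf).2 hf.eq⟩, by
    exact (Pi.single_smul (f := fun _ => rightIdeal f) i (op f) _).symm.trans
      (congrArg (Pi.single (M := fun _ => rightIdeal f) i) (Subtype.ext hf.eq))⟩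

theorem gen_apply_self (i : Fin r) :
    (gen hf r i).1 i = ⟨f, (mem_rightIdeal_iff hf).2 hf.eq⟩ :=
  Pi.single_eq_same (M := fun _ => rightIdeal f) i _

theorem gen_apply_of_ne {i j : Fin r} (h : j ≠ i) : (gen hf r i).1 j = 0 :=
  Pi.single_eq_of_ne (M := fun _ => rightIdeal f) h _

variable {M N : Type u} [AddCommGroup M] [Module Rᵐᵒᵖ M] [AddCommGroup N] [Module Rᵐᵒᵖ N]

/-- The map from `(fR)ʳ` given by a family of elements of `Mf`. -/
def desc (y : Fin r → FixedPart hf M) : Cover f r →ₗ[Rᵐᵒᵖ] M where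
  toFun q := ∑ i, op (q i).1 • (y i).1
  map_add' p q := by
    rw [← Finset.sum_add_distrib]
    refine Finset.sum_congr rfl fun i _ => ?_
    rw [← add_smul]
    rfl
  map_smul' a q := by
    rw [RingHom.id_apply, Finset.smul_sum]
    refine Finset.sum_congr rfl fun i _ => ?_
    rw [smul_smul]
    rfl

theorem desc_apply (y : Fin r → FixedPart hf M) (q : Cover f r) :
    desc hf y q = ∑ i, op (q i).1 • (y i).1 := rfl

theorem desc_gen (y : Fin r → FixedPart hf M) (i : Fin r) : desc hf y (gen hf r i).1 = (y i).1 := by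
  rw [desc_apply, Finset.sum_eq_single_of_mem i (Finset.mem_univ i)]
  · rw [gen_apply_self]
    exact (y i).2
  · intro j _ hj
    rw [gen_apply_of_ne hf hj]
    exact zero_smul _ _

theorem desc_gen_self (q : Cover f r) : desc hf (gen hf r) q = q := by
  rw [desc_apply]
  funext j
  refine (Finset.sum_apply j _ _).trans ?_
  refine (Finset.sum_eq_single_of_mem j (Finset.mem_univ j) ?_).trans ?_
  · intro i _ hi
    change op (q i).1 • (gen hf r i).1 j = 0
    rw [gen_apply_of_ne hf hi.symm, smul_zero]
  · change op (q j).1 • (gen hf r j).1 j = q j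
    rw [gen_apply_self]
    exact Subtype.ext ((mem_rightIdeal_iff hf).1 (q j).2)

theorem hom_ext {g h : Cover f r →ₗ[Rᵐᵒᵖ] M} (hgh : ∀ i, g (gen hf r i).1 = h (gen hf r i).1) :
    g = h := by
  refine LinearMap.ext fun q => ?_
  rw [← desc_gen_self hf q, desc_apply, map_sum, map_sum]
  exact Finset.sum_congr rfl fun i _ => by rw [map_smul, map_smul, hgh]

theorem projective_cover (hf : IsIdempotentElem f) (r : ℕ) :
    Module.Projective Rᵐᵒᵖ (Cover f r) := by
  refine Module.Projective.of_lifting_property'' fun g hg => ?_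
  choose y hy using fun i => hg (gen hf r i).1
  refine ⟨desc hf fun i => proj hf (y i), hom_ext hf fun i => ?_⟩
  rw [LinearMap.comp_apply, desc_gen]
  change g (op f • y i) = _
  rw [map_smul, hy]
  exact (gen hf r i).2

/-- The coordinates of an element of `(fRf)ʳ`. -/
def coord (q : FixedPart hf (Cover f r)) (i : Fin r) : hf.Corner :=
  ⟨(q.1 i).1, (Subsemigroup.mem_corner_iff hf).2 ⟨(mem_rightIdeal_iff hf).1 (q.1 i).2, by
    have : (op f • q.1) i = q.1 i := congrFun q.2 i
    exact congrArg Subtype.val this⟩⟩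

theorem sum_coord_smul_gen (q : FixedPart hf (Cover f r)) :
    ∑ i, op (coord hf q i) • gen hf r i = q := by
  refine ext hf ?_
  rw [coe_sum]
  exact desc_gen_self hf q.1

/-- The fixed part of (fR)^r is the free module (fRf)^r on the canonical generators. -/
theorem projective_fixedPart_cover : Module.Projective hf.Cornerᵐᵒᵖ (FixedPart hf (Cover f r)) := by
  refine Module.Projective.of_lifting_property'' fun g hg => ?_
  choose z hz using fun i => hg (gen hf r i)
  refine ⟨⟨⟨fun q => ∑ i, op (coord hf q i) • z i, fun p q => ?_⟩, fun c q => ?_⟩,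
    LinearMap.ext fun q => ?_⟩
  · rw [← Finset.sum_add_distrib]
    exact Finset.sum_congr rfl fun i _ => add_smul (op (coord hf p i)) (op (coord hf q i)) (z i)
  · rw [RingHom.id_apply, Finset.smul_sum]
    change ∑ i, (c * op (coord hf q i)) • z i = _
    exact Finset.sum_congr rfl fun i _ => mul_smul c (op (coord hf q i)) (z i)
  · change g (∑ i, op (coord hf q i) • z i) = q
    rw [map_sum]
    conv_rhs => rw [← sum_coord_smul_gen hf q]
    exact Finset.sum_congr rfl fun i _ => by rw [map_smul, hz]

/-- If the source of a map from `(fR)ʳ` splits on fixed parts, the splitting comes from an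
idempotent endomorphism. -/
theorem exists_idempotent (h : Cover f r →ₗ[Rᵐᵒᵖ] M)
    (s : FixedPart hf M →ₗ[hf.Cornerᵐᵒᵖ] FixedPart hf (Cover f r)) (hs : ∀ x, map hf h (s x) = x) :
    ∃ k : Cover f r →ₗ[Rᵐᵒᵖ] Cover f r, h ∘ₗ k = h ∧ k ∘ₗ k = k ∧
      ∀ q : FixedPart hf (Cover f r), k q.1 = (s (map hf h q)).1 := by
  -- The generators of (fR)^r lie in its fixed part, so the idempotent `s ∘ h` of (fRf)^r extends to
  -- an `R`-linear endomorphism.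
  let k := desc hf fun i => s (map hf h (gen hf r i))
  have hk : ∀ q : FixedPart hf (Cover f r), k q.1 = (s (map hf h q)).1 := by
    intro q
    conv_rhs => rw [← sum_coord_smul_gen hf q, map_sum, map_sum, coe_sum]
    rw [desc_apply]
    refine Finset.sum_congr rfl fun i _ => ?_
    rw [map_smul, map_smul]
    rfl
  refine ⟨k, hom_ext hf fun i => ?_, hom_ext hf fun i => ?_, hk⟩
  · rw [LinearMap.comp_apply, hk]
    exact congrArg Subtype.val (hs _)
  · rw [LinearMap.comp_apply, hk, hk, hs]

end FixedPart

end

section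

/-! ### Existence of approximations -/

namespace IsApproximated

open MulOpposite

variable {R : Type u} [Ring R] {f : R}

theorem op_smul_eq_zero {S : Type u} [AddCommGroup S] [Module Rᵐᵒᵖ S]
    (hS : ∀ x : S, op (1 - f) • x = x) (x : S) : op f • x = 0 := by
  have := hS x
  rwa [MulOpposite.op_sub, sub_smul, op_one, one_smul, sub_eq_self] at this

/-- The generators are fixed by `f`, whereas `f` kills the target. -/
theorem cover_hom_eq_zero (hf : IsIdempotentElem f) {r : ℕ} {S : Type u} [AddCommGroup S]
    [Module Rᵐᵒᵖ S] (hS : ∀ x : S, op (1 - f) • x = x)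
    (φ : FixedPart.Cover f r →ₗ[Rᵐᵒᵖ] S) : φ = 0 := by
  refine FixedPart.hom_ext hf fun i => ?_
  rw [LinearMap.zero_apply, ← op_smul_eq_zero hS (φ _), ← map_smul]
  exact congrArg φ (FixedPart.gen hf r i).2.symm

/-- The zero complex approximates `M`, with `M` itself as homology. -/
theorem of_fixed {A : Type u} [Ring A] {g : A} {M : ModuleCat.{u} A} (hM : Module.Finite A M)
    (h : ∀ x : M, g • x = x) : ∃ l, IsApproximated g M l := by
  let O := ModuleCat.of A PUnit.{u + 1}
  refine ⟨[M], cons (B := O) (Z := O) (Q := O) 0 LinearMap.id (fun _ _ _ => rfl)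
    Function.surjective_id ?_ LinearMap.id 0 Function.injective_id (fun x => ⟨0, rfl⟩) ?_
    ?_ (fun S _ φ => ?_) h hM (nil O ?_)⟩
  · intro x
    simp [eq_comm]
  · intro x
    simp [Subsingleton.elim x 0]
  · exact inferInstanceAs (Module.Projective A PUnit.{u + 1})
  · ext x
    rw [Subsingleton.elim x (0 : PUnit.{u+1})]
    exact map_zero φ
  · exact inferInstanceAs (Subsingleton PUnit.{u + 1})

variable [IsNoetherianRing Rᵐᵒᵖ] (hf : IsIdempotentElem f)

include hf

/-- The submodule generated by the fixed part is covered by a power of `fR`. -/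
theorem exists_cover (M : ModuleCat.{u} Rᵐᵒᵖ) (hM : Module.Finite Rᵐᵒᵖ M) :
    ∃ (r : ℕ) (h : FixedPart.Cover f r →ₗ[Rᵐᵒᵖ] M),
      Function.Surjective (FixedPart.map hf h) ∧
      (∀ x : M ⧸ LinearMap.range h, op (1 - f) • x = x) := by
  let B : Submodule Rᵐᵒᵖ M := Submodule.span Rᵐᵒᵖ {x | op f • x = x}
  have hB : B.FG := IsNoetherian.noetherian B
  obtain ⟨t, ht, htB⟩ := Submodule.fg_span_iff_fg_span_finset_subset _ |>.1 hB
  let y : Fin t.card → FixedPart hf M := fun i => ⟨(t.equivFin.symm i).1, ht (t.equivFin.symm i).2⟩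
  have hrange : LinearMap.range (FixedPart.desc hf y) = B := by
    refine le_antisymm ?_ ?_
    · rintro _ ⟨q, rfl⟩
      rw [FixedPart.desc_apply]
      exact Submodule.sum_mem _ fun i _ => Submodule.smul_mem _ _ (Submodule.subset_span (y i).2)
    · change Submodule.span Rᵐᵒᵖ {x | op f • x = x} ≤ _
      rw [htB, Submodule.span_le]
      intro x hx
      refine ⟨(FixedPart.gen hf _ (t.equivFin ⟨x, hx⟩)).1, ?_⟩
      rw [FixedPart.desc_gen]
      simp [y]
  refine ⟨t.card, FixedPart.desc hf y, ?_, ?_⟩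
  · intro x
    have : x.1 ∈ LinearMap.range (FixedPart.desc hf y) := by
      rw [hrange]
      exact Submodule.subset_span x.2
    obtain ⟨q, hq⟩ := this
    refine ⟨FixedPart.proj hf q, FixedPart.ext hf ?_⟩
    change FixedPart.desc hf y (op f • q) = x.1
    rw [map_smul, hq]
    exact x.2
  · intro x
    obtain ⟨x, rfl⟩ := Submodule.mkQ_surjective _ x
    have hx : op f • x ∈ LinearMap.range (FixedPart.desc hf y) := by
      rw [hrange]
      refine Submodule.subset_span ?_
      change op f • op f • x = op f • x
      rw [smul_smul, ← op_mul, hf.eq]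
    rw [MulOpposite.op_sub, sub_smul, op_one, one_smul, ← map_smul, sub_eq_self]
    exact (Submodule.Quotient.mk_eq_zero _).2 hx

/-- A resolution over `fRf` of the fixed part lifts term by term, because (fRf)^r is the fixed part
of (fR)^r. Passing to fixed parts is exact, so the failure of exactness over `R` consists of modules
killed by `f`; these become the homology. -/
theorem exists_of_hasProjectiveDimensionLE (n : ℕ) (M : ModuleCat.{u} Rᵐᵒᵖ)
    (hM : Module.Finite Rᵐᵒᵖ M)
    (hpd : HasProjectiveDimensionLE (ModuleCat.of hf.Cornerᵐᵒᵖ (FixedPart hf M)) n) :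
    ∃ l, IsApproximated (op (1 - f)) M l := by
  induction n generalizing M with
  | zero =>
    obtain ⟨r, h, hh, hH⟩ := exists_cover hf M hM
    have hproj : Module.Projective hf.Cornerᵐᵒᵖ (FixedPart hf M) :=
      (IsProjective.iff_projective (R := hf.Cornerᵐᵒᵖ) (FixedPart hf M)).2
        ((projective_iff_hasProjectiveDimensionLE_zero _).2 hpd)
    obtain ⟨s, hs⟩ := Module.projective_lifting_property (FixedPart.map hf h) LinearMap.id hh
    -- The idempotent `k` cuts out of (fR)^r a summand with fixed part isomorphic to `Mf`. This
    -- summand is the last nonzero projective term.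
    obtain ⟨k, hhk, hkk, hk⟩ := FixedPart.exists_idempotent hf h s (LinearMap.congr_fun hs)
    have hkk' : ∀ x, k (k x) = k x := LinearMap.congr_fun hkk
    let ρ : LinearMap.range k →ₗ[Rᵐᵒᵖ] LinearMap.range h :=
      h.rangeRestrict ∘ₗ (LinearMap.range k).subtype
    have hρ : Function.Surjective ρ := by
      rintro ⟨_, q, rfl⟩
      exact ⟨⟨k q, q, rfl⟩, Subtype.ext (LinearMap.congr_fun hhk q)⟩
    -- For `x` in the kernel, xf = k(xf) = s(h(xf)) = s(0) = 0.
    have hker : ∀ x : LinearMap.ker ρ, op (1 - f) • x = x := by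
      intro x
      obtain ⟨q, hq⟩ := x.1.2
      have h₁ : k x.1.1 = x.1.1 := by rw [← hq, hkk']
      let z : FixedPart hf (FixedPart.Cover f r) := FixedPart.proj hf x.1.1
      have h₂ : FixedPart.map hf h z = 0 := by
        refine FixedPart.ext hf ?_
        change h (op f • x.1.1) = 0
        rw [map_smul]
        have : h x.1.1 = 0 := congrArg Subtype.val x.2
        rw [this, smul_zero]
      have h₃ : op f • x.1.1 = 0 := by
        rw [← h₁, ← map_smul]
        refine (hk z).trans ?_
        rw [h₂, map_zero]
        rfl
      refine Subtype.ext (Subtype.ext ?_)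
      change op (1 - f) • x.1.1 = x.1.1
      rw [MulOpposite.op_sub, sub_smul, op_one, one_smul, h₃, sub_zero]
    have hfin : Module.Finite Rᵐᵒᵖ (LinearMap.ker ρ) := inferInstance
    obtain ⟨l, hl⟩ := of_fixed (M := ModuleCat.of Rᵐᵒᵖ (LinearMap.ker ρ)) hfin hker
    refine ⟨_, cons (B := ModuleCat.of Rᵐᵒᵖ (LinearMap.range h))
      (H := ModuleCat.of Rᵐᵒᵖ (M ⧸ LinearMap.range h))
      (Q := ModuleCat.of Rᵐᵒᵖ (LinearMap.range k)) (LinearMap.range h).subtype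
      (LinearMap.range h).mkQ (LinearMap.range h).injective_subtype
      (LinearMap.range h).mkQ_surjective (LinearMap.exact_subtype_mkQ _)
      (LinearMap.ker ρ).subtype ρ (LinearMap.ker ρ).injective_subtype hρ
      (LinearMap.exact_subtype_ker_map ρ) ?_ ?_ hH ?_ hl⟩
    · have := FixedPart.projective_cover hf r
      refine Module.Projective.of_split (LinearMap.range k).subtype k.rangeRestrict ?_
      ext ⟨_, q, rfl⟩ : 2
      exact hkk' q
    · intro S hS φ
      refine (LinearMap.cancel_right k.surjective_rangeRestrict).1 ?_
      rw [LinearMap.zero_comp]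
      exact cover_hom_eq_zero hf hS _
    · exact inferInstanceAs (Module.Finite Rᵐᵒᵖ (M ⧸ LinearMap.range h))
  | succ n ih =>
    obtain ⟨r, h, hh, hH⟩ := exists_cover hf M hM
    have hfin : Module.Finite Rᵐᵒᵖ (LinearMap.ker h) := inferInstance
    let K := LinearMap.ker h
    have hex : Function.Exact (FixedPart.map hf K.subtype) (FixedPart.map hf h) := by
      intro q
      constructor
      · intro hq
        refine ⟨⟨⟨q.1, congrArg Subtype.val hq⟩, Subtype.ext q.2⟩, rfl⟩
      · rintro ⟨x, rfl⟩
        exact FixedPart.ext hf x.1.2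
    have hS := exactPair_shortExact (M₁ := ModuleCat.of _ (FixedPart hf K))
      (M₂ := ModuleCat.of _ (FixedPart hf (FixedPart.Cover f r)))
      (M₃ := ModuleCat.of _ (FixedPart hf M)) hex
      (fun x y hxy => by
        have : (FixedPart.map hf K.subtype x).1 = (FixedPart.map hf K.subtype y).1 := by rw [hxy]
        exact FixedPart.ext hf (Subtype.ext this)) hh
    have hP : Projective (ModuleCat.of hf.Cornerᵐᵒᵖ (FixedPart hf (FixedPart.Cover f r))) :=
      (IsProjective.iff_projective _).1 (FixedPart.projective_fixedPart_cover hf)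
    -- The fixed parts form a short exact sequence with projective middle term, so the fixed part of
    -- the kernel has projective dimension one less.
    obtain ⟨l, hl⟩ := ih (ModuleCat.of Rᵐᵒᵖ K) hfin
      (hS.hasProjectiveDimensionLT_X₁ (n + 1) inferInstance hpd)
    refine ⟨_, cons (B := ModuleCat.of Rᵐᵒᵖ (LinearMap.range h))
      (H := ModuleCat.of Rᵐᵒᵖ (M ⧸ LinearMap.range h))
      (Q := ModuleCat.of Rᵐᵒᵖ (FixedPart.Cover f r)) (LinearMap.range h).subtype
      (LinearMap.range h).mkQ (LinearMap.range h).injective_subtype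
      (LinearMap.range h).mkQ_surjective (LinearMap.exact_subtype_mkQ _)
      K.subtype h.rangeRestrict K.injective_subtype h.surjective_rangeRestrict
      ?_ (FixedPart.projective_cover hf r) (fun S hS φ => cover_hom_eq_zero hf hS φ) hH ?_ hl⟩
    · intro q
      have : h.rangeRestrict q = 0 ↔ h q = 0 := Subtype.ext_iff
      rw [this]
      exact LinearMap.exact_subtype_ker_map h q
    · exact inferInstanceAs (Module.Finite Rᵐᵒᵖ (M ⧸ LinearMap.range h))

end IsApproximated

end

/-! ### Idempotents in semiperfect basic rings -/

section Idempotents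

variable {R : Type u} [Ring R]

theorem isUnit_one_sub_of_mem_jacobson {x : R} (hx : x ∈ Ring.jacobson R) : IsUnit (1 - x) := by
  have key : ∀ y ∈ Ring.jacobson R, ∃ z, z * (1 - y) = 1 := by
    intro y hy
    rw [← Ideal.jacobson_bot] at hy
    obtain ⟨z, hz⟩ := Ideal.mem_jacobson_iff.1 hy (-1)
    refine ⟨z, ?_⟩
    rw [Ideal.mem_bot] at hz
    rw [← sub_eq_zero, ← hz]
    noncomm_ring
  obtain ⟨z, hz⟩ := key x hx
  -- The left inverse `z` of `1 - x` equals `1 + z * x`, hence has a left inverse itself; so `z` is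
  -- two-sided.
  obtain ⟨w, hw⟩ := key (-(z * x)) (neg_mem (Ideal.mul_mem_left _ z hx))
  have hz' : 1 - -(z * x) = z := by
    rw [sub_neg_eq_add]
    rw [mul_sub, mul_one, sub_eq_iff_eq_add] at hz
    exact hz.symm
  rw [hz'] at hw
  have hwx : w = 1 - x := by
    calc w = w * (z * (1 - x)) := by rw [hz, mul_one]
      _ = 1 - x := by rw [← mul_assoc, hw, one_mul]
  exact ⟨⟨1 - x, z, by rw [← hwx, hw], hz⟩, rfl⟩

theorem IsIdempotentElem.eq_zero_of_mem_jacobson {e : R} (he : IsIdempotentElem e)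
    (h : e ∈ Ring.jacobson R) : e = 0 := by
  have := (isUnit_one_sub_of_mem_jacobson h).mul_right_eq_zero (b := e)
  rw [sub_mul, one_mul, he.eq, sub_self] at this
  exact this.1 rfl

/-- Von Neumann regularity: the left ideal of `a` is generated by an idempotent `h = b * a`, and
right multiplication by `h` fixes `a`. -/
theorem exists_mul_mul_eq_self_of_isSemisimpleRing {B : Type u} [Ring B] [IsSemisimpleRing B]
    (a : B) : ∃ b, a * b * a = a := by
  obtain ⟨h, hh, hI⟩ := IsSemisimpleRing.ideal_eq_span_idempotent (Ideal.span {a})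
  obtain ⟨b, hb⟩ : ∃ b, b * a = h := Ideal.mem_span_singleton'.1 (by
    rw [hI]
    exact Ideal.mem_span_singleton_self h)
  obtain ⟨c, hc⟩ : ∃ c, c * h = a := Ideal.mem_span_singleton'.1 (by
    rw [← hI]
    exact Ideal.mem_span_singleton_self a)
  refine ⟨b, ?_⟩
  rw [mul_assoc, hb, ← hc, mul_assoc, hh.eq]

local notation "π" => Ideal.Quotient.mk (Ring.jacobson R)

theorem mk_eq_zero_iff {x : R} : π x = 0 ↔ x ∈ Ring.jacobson R := Ideal.Quotient.eq_zero_iff_mem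

/-- A primitive idempotent of a semiperfect ring stays primitive modulo the radical. -/
theorem IsPrimitiveIdempotent.mk_eq_zero_or (hsp : IsSemiperfectRing R) {ε : R}
    (hε : IsPrimitiveIdempotent ε) {h : R ⧸ Ring.jacobson R} (hh : IsIdempotentElem h)
    (hl : π ε * h = h) (hr : h * π ε = h) : h = 0 ∨ h = π ε := by
  obtain ⟨hε₁, -, hε₃⟩ := hε
  obtain ⟨a, ha, rfl⟩ := hsp.2 h hh
  have hJ : a - a * ε ∈ Ring.jacobson R := by
    rw [← mk_eq_zero_iff, map_sub, map_mul, hr, sub_self]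
  -- The unit `u = 1 - (a - a * ε)` is 1 modulo the radical and satisfies `a * u = a * ε`. Hence
  -- `u⁻¹ * a * ε` is an idempotent lifting `h`, and multiplying it by `ε` on the left puts it into
  -- the corner of `ε`.
  obtain ⟨u, hu⟩ := isUnit_one_sub_of_mem_jacobson hJ
  have hau : a * u = a * ε := by
    rw [hu, mul_sub, mul_one, mul_sub, ← mul_assoc, ha.eq, sub_sub_cancel]
  have hπu : π u = 1 := by
    rw [hu, map_sub, mk_eq_zero_iff.2 hJ, map_one, sub_zero]
  have hπu' : π (↑u⁻¹ : R) = 1 := by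
    have : π ((↑u⁻¹ : R) * u) = 1 := by rw [Units.inv_mul, map_one]
    rwa [map_mul, hπu, mul_one] at this
  have hb' : (↑u⁻¹ : R) * a * ε = ↑u⁻¹ * a * u := by rw [mul_assoc, ← hau, mul_assoc]
  let b := ε * (↑u⁻¹ * a * ε)
  have hid : (↑u⁻¹ * a * ε) * (↑u⁻¹ * a * ε) = ↑u⁻¹ * a * ε := by
    rw [hb']
    calc (↑u⁻¹ * a * ↑u : R) * (↑u⁻¹ * a * ↑u) = ↑u⁻¹ * a * (↑u * ↑u⁻¹) * a * ↑u := by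
          noncomm_ring
      _ = ↑u⁻¹ * (a * a) * ↑u := by rw [Units.mul_inv]; noncomm_ring
      _ = _ := by rw [ha.eq]
  have hεb : ε * b = b := by rw [← mul_assoc, hε₁.eq]
  have hbε : b * ε = b := by simp only [b, mul_assoc, hε₁.eq]
  have hb : b * b = b := by
    calc b * b = ε * ((↑u⁻¹ * a * (ε * ε)) * (↑u⁻¹ * a * ε)) := by simp only [b]; noncomm_ring
      _ = b := by rw [hε₁.eq, hid]
  have hπb : π b = π a := by
    simp only [b, map_mul, hπu', one_mul]
    rw [hr, hl]
  rcases hε₃ b (ε - b) hb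
    (by
      change (ε - b) * (ε - b) = ε - b
      rw [sub_mul, mul_sub, mul_sub, hε₁.eq, hεb, hbε, hb, sub_self, sub_zero])
    (by rw [mul_sub, hbε, hb, sub_self]) (by rw [sub_mul, hεb, hb, sub_self])
    (add_sub_cancel _ _) with h0 | h0
  · left
    rw [← hπb, h0, map_zero]
  · right
    rw [← hπb, ← sub_eq_zero.1 h0]

/-- Regularity modulo the radical yields a nonzero idempotent `ε * x * b * ε` in the corner of `ε`,
which must be the image of `ε`. The remaining error lies in the radical and is removed by a unit. -/
theorem IsPrimitiveIdempotent.exists_mul_eq (hsp : IsSemiperfectRing R) {ε : R}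
    (hε : IsPrimitiveIdempotent ε) {x : R} (hx : ε * x ∉ Ring.jacobson R) :
    ∃ y, ε * x * y = ε := by
  have := hsp.1
  have hε₁ : ε * ε = ε := hε.1
  have hπε : π ε * π ε = π ε := by rw [← map_mul, hε₁]
  obtain ⟨b, hb⟩ := exists_mul_mul_eq_self_of_isSemisimpleRing (π (ε * x))
  obtain ⟨b, rfl⟩ := Ideal.Quotient.mk_surjective b
  have hεg : π ε * π (ε * x) = π (ε * x) := by rw [← map_mul, ← mul_assoc, hε₁]
  have hid : IsIdempotentElem (π (ε * x) * π b * π ε) := by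
    calc (π (ε * x) * π b * π ε) * (π (ε * x) * π b * π ε)
        = π (ε * x) * π b * (π ε * π (ε * x)) * π b * π ε := by noncomm_ring
      _ = _ := by rw [hεg, hb]
  rcases hε.mk_eq_zero_or hsp hid (by rw [← mul_assoc, ← mul_assoc, hεg])
    (by rw [mul_assoc, hπε]) with h | h
  · exfalso
    apply hx
    rw [← mk_eq_zero_iff]
    calc π (ε * x) = π (ε * x) * π b * π (ε * x) := hb.symm
      _ = π (ε * x) * π b * (π ε * π (ε * x)) := by rw [hεg]
      _ = (π (ε * x) * π b * π ε) * π (ε * x) := by noncomm_ring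
      _ = 0 := by rw [h, zero_mul]
  · have hJ : ε - ε * x * b * ε ∈ Ring.jacobson R := by
      rw [← mk_eq_zero_iff, map_sub, map_mul _ _ ε, map_mul _ _ b, h, sub_self]
    obtain ⟨u, hu⟩ := isUnit_one_sub_of_mem_jacobson hJ
    have hεu : ε * u = ε * x * b * ε := by
      rw [hu]
      calc ε * (1 - (ε - ε * x * b * ε)) = ε - ε * ε + ε * ε * x * b * ε := by noncomm_ring
        _ = _ := by rw [hε₁, sub_self, zero_add]
    refine ⟨b * ε * ↑u⁻¹, ?_⟩
    calc ε * x * (b * ε * ↑u⁻¹) = (ε * x * b * ε) * ↑u⁻¹ := by noncomm_ring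
      _ = ε := by rw [← hεu, mul_assoc, Units.mul_inv, mul_one]

/-- If `a = ε * x * ε'` is not in the radical, there is `c` with `a * c = ε`. Then `c * a` is a
nonzero idempotent in the corner of `ε'`, so it equals `ε'`, and multiplications by `c` and `a`
identify the two right ideals. -/
theorem IsPrimitiveIdempotent.mul_mul_mem_jacobson (hsp : IsSemiperfectRing R) {ε ε' : R}
    (hε : IsPrimitiveIdempotent ε) (hε' : IsPrimitiveIdempotent ε')
    (hiso : IsEmpty (rightIdeal ε ≃ₗ[Rᵐᵒᵖ] rightIdeal ε')) (x : R) :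
    ε * x * ε' ∈ Ring.jacobson R := by
  by_contra hx
  rw [mul_assoc] at hx
  obtain ⟨y, hy⟩ := hε.exists_mul_eq hsp hx
  have h₁ : ε * ε = ε := hε.1
  have h₁' : ε' * ε' = ε' := hε'.1
  set a := ε * x * ε' with ha
  set c := ε' * y * ε with hc
  have hac : a * c = ε := by
    calc a * c = ε * (x * (ε' * ε')) * y * ε := by rw [ha, hc]; noncomm_ring
      _ = ε := by rw [h₁', hy, h₁]
  have hεa : ε * a = a := by rw [ha, ← mul_assoc, ← mul_assoc, h₁]
  have hε'c : ε' * c = c := by rw [hc, ← mul_assoc, ← mul_assoc, h₁']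
  have haε' : a * ε' = a := by rw [ha, mul_assoc, h₁']
  have hcε : c * ε = c := by rw [hc, mul_assoc, h₁]
  have hca : c * a = ε' := by
    have hid : (c * a) * (c * a) = c * a := by
      rw [mul_assoc, ← mul_assoc a, hac, hεa]
    have hl : ε' * (c * a) = c * a := by rw [← mul_assoc, hε'c]
    have hr : c * a * ε' = c * a := by rw [mul_assoc, haε']
    rcases hε'.2.2 (c * a) (ε' - c * a) hid
      (by
        change (ε' - c * a) * (ε' - c * a) = ε' - c * a
        rw [sub_mul, mul_sub, mul_sub, h₁', hl, hr, hid, sub_self, sub_zero])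
      (by rw [mul_sub, hr, hid, sub_self]) (by rw [sub_mul, hl, hid, sub_self])
      (add_sub_cancel _ _) with h | h
    · exfalso
      apply hε.2.1
      calc ε = (a * c) * (a * c) := by rw [hac, h₁]
        _ = a * (c * a) * c := by noncomm_ring
        _ = 0 := by rw [h, mul_zero, zero_mul]
    · exact (sub_eq_zero.1 h).symm
  have hmem : ∀ z : rightIdeal ε, ε * z.1 = z.1 := fun z =>
    (FixedPart.mem_rightIdeal_iff hε.1).1 z.2
  have hmem' : ∀ z : rightIdeal ε', ε' * z.1 = z.1 := fun z =>
    (FixedPart.mem_rightIdeal_iff hε'.1).1 z.2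
  refine hiso.false ⟨⟨⟨fun z => ⟨c * z.1, ?_⟩, fun z w => ?_⟩, fun r z => ?_⟩,
    fun z => ⟨a * z.1, ?_⟩, fun z => ?_, fun z => ?_⟩
  · rw [FixedPart.mem_rightIdeal_iff hε'.1, ← mul_assoc, hε'c]
  · exact Subtype.ext (mul_add _ _ _)
  · exact Subtype.ext (mul_assoc _ _ _).symm
  · rw [FixedPart.mem_rightIdeal_iff hε.1, ← mul_assoc, hεa]
  · exact Subtype.ext (by
      change a * (c * z.1) = z.1
      rw [← mul_assoc, hac, hmem])
  · exact Subtype.ext (by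
      change c * (a * z.1) = z.1
      rw [← mul_assoc, hca, hmem'])

/-- A complete family of orthogonal idempotents with local right ideals, pairwise non-isomorphic
modulo the radical. -/
structure IsLocalFamily {n : ℕ} (ε : Fin n → R) : Prop where
  complete : CompleteOrthogonalIdempotents ε
  notMem : ∀ i, ε i ∉ Ring.jacobson R
  exists_mul_eq : ∀ i x, ε i * x ∉ Ring.jacobson R → ∃ y, ε i * x * y = ε i
  mul_mul_mem : ∀ i j, i ≠ j → ∀ x, ε i * x * ε j ∈ Ring.jacobson R

/-- Every idempotent of a semiperfect basic ring is a partial sum of a suitable basic family. -/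
theorem exists_isLocalFamily (hsp : IsSemiperfectRing R) (hbasic : IsBasicRing R) {e : R}
    (he : IsIdempotentElem e) :
    ∃ (n : ℕ) (ε : Fin n → R) (I : Finset (Fin n)), IsLocalFamily ε ∧ e = ∑ i ∈ I, ε i := by
  classical
  obtain ⟨n, ε, hε, hprim, hiso⟩ := hbasic
  have hJ : ∀ i j, i ≠ j → ∀ x, ε i * x * ε j ∈ Ring.jacobson R := fun i j hij =>
    (hprim i).mul_mul_mem_jacobson hsp (hprim j) (hiso i j hij)
  -- The off-diagonal blocks lie in the radical. Consequently the image of `ε i * e` is an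
  -- idempotent in the corner of the image of `ε i`, hence zero or everything, and `e` agrees with a
  -- partial sum `g` modulo the radical.
  have hcomm : ∀ x i, π (ε i * x) = π (ε i * x * ε i) := by
    intro x i
    conv_lhs => rw [← mul_one (ε i * x), ← hε.complete, Finset.mul_sum, map_sum]
    refine Finset.sum_eq_single_of_mem i (Finset.mem_univ i) fun j _ hj => ?_
    exact mk_eq_zero_iff.2 (hJ i j hj.symm x)
  have hdich : ∀ i, π (ε i * e) = 0 ∨ π (ε i * e) = π (ε i) := by
    intro i
    have hi : ε i * ε i = ε i := (hε.idem i).eq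
    refine (hprim i).mk_eq_zero_or hsp ?_ ?_ ?_
    · change π (ε i * e) * π (ε i * e) = π (ε i * e)
      rw [← map_mul]
      calc π (ε i * e * (ε i * e)) = π (ε i * e * ε i) * π e := by
            rw [← map_mul]; congr 1; noncomm_ring
        _ = π (ε i * e) := by
            rw [← hcomm, ← map_mul, mul_assoc, he.eq]
    · rw [← map_mul, ← mul_assoc, hi]
    · rw [← map_mul, ← hcomm]
  let I : Finset (Fin n) := Finset.univ.filter fun i => π (ε i * e) ≠ 0
  let g := ∑ i ∈ I, ε i
  have hg : g * g = g := hε.isIdempotentElem_sum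
  have heg : π e = π g := by
    conv_lhs => rw [← one_mul e, ← hε.complete, Finset.sum_mul, map_sum]
    simp only [g, map_sum, I, Finset.sum_filter]
    refine Finset.sum_congr rfl fun i _ => ?_
    split_ifs with h
    · exact (hdich i).resolve_left h
    · exact not_not.1 h
  -- As `e` and `g` agree modulo the radical, u = eg + (1-e)(1-g) is a unit, and eu = eg = ug. So
  -- `u` conjugates `g` into `e`.
  have hu : 1 - (e * g + (1 - e) * (1 - g)) ∈ Ring.jacobson R := by
    have hgg : π g * π g = π g := by rw [← map_mul, hg]
    rw [← mk_eq_zero_iff]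
    simp only [map_sub, map_add, map_mul, map_one, heg, mul_sub, sub_mul, hgg, mul_one, one_mul]
    abel
  obtain ⟨u, hu⟩ := isUnit_one_sub_of_mem_jacobson hu
  rw [sub_sub_cancel] at hu
  have heu : e * u = u * g := by
    have h₁ : e * u = e * g := by
      rw [hu, mul_add, ← mul_assoc, he.eq, ← mul_assoc e, mul_sub e, mul_one, he.eq, sub_self,
        zero_mul, add_zero]
    have h₂ : u * g = e * g := by
      rw [hu, add_mul, mul_assoc, hg, mul_assoc, sub_mul 1 g, one_mul, hg, sub_self, mul_zero,
        add_zero]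
    rw [h₁, h₂]
  let ε' : Fin n → R := fun i => u * ε i * ↑u⁻¹
  have hmul : ∀ a b : R, (u * a * ↑u⁻¹) * (u * b * ↑u⁻¹) = u * (a * b) * ↑u⁻¹ := by
    intro a b
    calc (u * a * ↑u⁻¹ : R) * (u * b * ↑u⁻¹) = u * a * (↑u⁻¹ * u) * b * ↑u⁻¹ := by noncomm_ring
      _ = _ := by rw [Units.inv_mul]; noncomm_ring
  have hconj : ∀ a : R, u * a * (↑u⁻¹ : R) ∈ Ring.jacobson R → a ∈ Ring.jacobson R := by
    intro a ha
    have := Ideal.mul_mem_left _ (↑u⁻¹ : R) (Ideal.mul_mem_right (u : R) _ ha)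
    rwa [mul_assoc, mul_assoc, Units.inv_mul, mul_one, ← mul_assoc, Units.inv_mul, one_mul] at this
  refine ⟨n, ε', I, ⟨⟨⟨fun i => ?_, fun i j hij => ?_⟩, ?_⟩, fun i hi => ?_, fun i x hx => ?_,
    fun i j hij x => ?_⟩, ?_⟩
  · change ε' i * ε' i = ε' i
    simp only [ε', hmul, (hε.idem i).eq]
  · change ε' i * ε' j = 0
    have : ε i * ε j = 0 := hε.ortho hij
    simp only [ε', hmul, this, mul_zero, zero_mul]
  · simp only [ε', ← Finset.sum_mul, ← Finset.mul_sum, hε.complete, mul_one, Units.mul_inv]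
  · exact (hprim i).2.1 ((hε.idem i).eq_zero_of_mem_jacobson (hconj _ hi))
  · have hx' : ε i * (↑u⁻¹ * x) ∉ Ring.jacobson R := fun h => hx (by
      have := Ideal.mul_mem_left _ (u : R) h
      simpa only [ε', mul_assoc] using this)
    obtain ⟨y, hy⟩ := (hprim i).exists_mul_eq hsp hx'
    refine ⟨y * ↑u⁻¹, ?_⟩
    calc ε' i * x * (y * ↑u⁻¹) = u * (ε i * (↑u⁻¹ * x) * y) * ↑u⁻¹ := by
          simp only [ε', mul_assoc]
      _ = ε' i := by rw [hy]
  · have := Ideal.mul_mem_right (↑u⁻¹ : R) _ (Ideal.mul_mem_left _ (u : R) (hJ i j hij (↑u⁻¹ * x * u)))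
    simpa only [ε', mul_assoc] using this
  · calc e = e * u * ↑u⁻¹ := by rw [mul_assoc, Units.mul_inv, mul_one]
      _ = ∑ i ∈ I, ε' i := by
        rw [heu]
        simp only [g, ε', Finset.mul_sum, Finset.sum_mul]

end Idempotents

section

/-! ### The simple right modules of a local family -/

open MulOpposite

section RadicalPart

variable {R : Type u} [Ring R]

/-- The submodule `εJ` of `εR`, where `J` is the Jacobson radical. -/
def radicalPart (ε : R) : Submodule Rᵐᵒᵖ (rightIdeal ε) where
  carrier := {x | x.1 ∈ Ring.jacobson R}
  add_mem' hx hy := (Ring.jacobson R).add_mem hx hy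
  zero_mem' := (Ring.jacobson R).zero_mem
  smul_mem' a _ hx := Ideal.mul_mem_right (unop a) (Ring.jacobson R) hx

/-- The generator of `εR`. -/
def rightIdealGen (ε : R) : rightIdeal ε := ⟨ε, Submodule.mem_span_singleton_self ε⟩

theorem rightIdealGen_smul {ε : R} (hε : IsIdempotentElem ε) :
    op ε • rightIdealGen ε = rightIdealGen ε :=
  Subtype.ext hε.eq

theorem exists_rightIdeal_hom {ε : R} {M : Type u} [AddCommGroup M]
    [Module Rᵐᵒᵖ M] (x : M) (hx : op ε • x = x) :
    ∃ g : rightIdeal ε →ₗ[Rᵐᵒᵖ] M, g (rightIdealGen ε) = x :=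
  ⟨⟨⟨fun r => op r.1 • x, fun r s => by
    change op (r.1 + s.1) • x = _
    rw [MulOpposite.op_add, add_smul]⟩, fun a r => by
    change op (r.1 * unop a) • x = a • op r.1 • x
    rw [op_mul, op_unop, mul_smul]⟩, hx⟩

variable {n : ℕ} {ε : Fin n → R}

namespace IsLocalFamily

theorem rightIdeal_span_eq_top (h : IsLocalFamily ε) {i : Fin n} {x : rightIdeal (ε i)}
    (hx : x ∉ radicalPart (ε i)) : Submodule.span Rᵐᵒᵖ {x} = ⊤ := by
  have hεx : ε i * x.1 = x.1 := (FixedPart.mem_rightIdeal_iff (h.complete.idem i)).1 x.2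
  obtain ⟨y, hy⟩ := h.exists_mul_eq i x.1 (by rwa [hεx])
  rw [hεx] at hy
  rw [eq_top_iff]
  intro z _
  rw [Submodule.mem_span_singleton]
  refine ⟨op (y * z.1), Subtype.ext ?_⟩
  change x.1 * (y * z.1) = z.1
  rw [← mul_assoc, hy]
  exact (FixedPart.mem_rightIdeal_iff (h.complete.idem i)).1 z.2

theorem isCoatom_radicalPart (h : IsLocalFamily ε) (i : Fin n) :
    IsCoatom (radicalPart (ε i)) := by
  refine ⟨fun htop => h.notMem i ?_, fun K hK => ?_⟩
  · have : rightIdealGen (ε i) ∈ radicalPart (ε i) := htop ▸ Submodule.mem_top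
    exact this
  · obtain ⟨x, hxK, hx⟩ := SetLike.exists_of_lt hK
    rw [eq_top_iff, ← h.rightIdeal_span_eq_top hx, Submodule.span_singleton_le_iff_mem]
    exact hxK

/-- Any element outside `radicalPart` generates, so `radicalPart` is the only maximal submodule. -/
theorem jacobson_rightIdeal (h : IsLocalFamily ε) (i : Fin n) :
    Module.jacobson Rᵐᵒᵖ (rightIdeal (ε i)) = radicalPart (ε i) := by
  refine le_antisymm (sInf_le (h.isCoatom_radicalPart i)) (le_sInf fun m hm => ?_)
  have hle : m ≤ radicalPart (ε i) := by
    intro x hx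
    by_contra hx'
    refine hm.1 (eq_top_iff.2 ?_)
    rw [← h.rightIdeal_span_eq_top hx', Submodule.span_singleton_le_iff_mem]
    exact hx
  rcases hm.le_iff.1 hle with htop | heq
  · exact absurd htop (h.isCoatom_radicalPart i).1
  · exact heq.le

theorem mul_sub_self_mem (h : IsLocalFamily ε) (i : Fin n) (x : R) :
    ε i * x * ε i - ε i * x ∈ Ring.jacobson R := by
  classical
  have : ε i * x = ∑ j, ε i * x * ε j := by
    rw [← Finset.mul_sum, h.complete.complete, mul_one]
  rw [← neg_mem_iff, neg_sub]
  nth_rw 1 [this]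
  rw [← Finset.sum_erase_add _ _ (Finset.mem_univ i), add_sub_cancel_right]
  exact sum_mem fun j hj => h.mul_mul_mem i j (Finset.ne_of_mem_erase hj).symm x

/-- The simple right modules attached to a local family. -/
noncomputable def localSystem (h : IsLocalFamily ε) : LocalSystem Rᵐᵒᵖ (Fin n) where
  ε i := op (ε i)
  P i := ModuleCat.of Rᵐᵒᵖ (rightIdeal (ε i))
  S i := topModule (ε i)
  p i := rightIdealGen (ε i)
  q i := (Module.jacobson Rᵐᵒᵖ (rightIdeal (ε i))).mkQ
  idem i := by rw [← op_mul, (h.complete.idem i).eq]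
  smul_p i := rightIdealGen_smul (h.complete.idem i)
  lift i M x hx := exists_rightIdeal_hom x hx
  span_eq_top i x hx := h.rightIdeal_span_eq_top fun hx' => hx (by
    rw [← h.jacobson_rightIdeal] at hx'
    exact (Submodule.Quotient.mk_eq_zero _).2 hx')
  q_p_ne_zero i hp := h.notMem i (by
    have := (Submodule.Quotient.mk_eq_zero _).1 hp
    rw [h.jacobson_rightIdeal] at this
    exact this)
  simple i := by
    have := h.isCoatom_radicalPart i
    rw [← h.jacobson_rightIdeal] at this
    exact isSimpleModule_iff_isCoatom.2 this
  smul_eq_zero i j hij x := by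
    obtain ⟨x, rfl⟩ := Submodule.mkQ_surjective _ x
    refine (Submodule.Quotient.mk_eq_zero (Module.jacobson Rᵐᵒᵖ (rightIdeal (ε j)))
      (x := op (ε i) • x)).2 ?_
    rw [h.jacobson_rightIdeal]
    have := h.mul_mul_mem j i hij.symm x.1
    rw [(FixedPart.mem_rightIdeal_iff (h.complete.idem j)).1 x.2] at this
    exact this
  smul_eq_self i x := by
    obtain ⟨x, rfl⟩ := Submodule.mkQ_surjective _ x
    refine (Submodule.Quotient.eq (Module.jacobson Rᵐᵒᵖ (rightIdeal (ε i)))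
      (x := op (ε i) • x) (y := x)).2 ?_
    rw [h.jacobson_rightIdeal]
    have := h.mul_sub_self_mem i x.1
    rw [(FixedPart.mem_rightIdeal_iff (h.complete.idem i)).1 x.2] at this
    exact this

end IsLocalFamily

end RadicalPart

end

section

open MulOpposite

/-! ### Decomposition of the top of a projective module -/

section Top

variable {R : Type u} [Ring R]

/-- The projection to the top. -/
noncomputable def topMk (e : R) : rightIdeal e →ₗ[Rᵐᵒᵖ] topModule e :=
  (Module.jacobson Rᵐᵒᵖ (rightIdeal e)).mkQ

theorem topMk_surjective (e : R) : Function.Surjective (topMk e) := Submodule.mkQ_surjective _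

/-- The map induced on tops. -/
noncomputable def topMap {e e' : R} (f : rightIdeal e →ₗ[Rᵐᵒᵖ] rightIdeal e') :
    topModule e →ₗ[Rᵐᵒᵖ] topModule e' :=
  Submodule.mapQ _ _ f (Module.le_comap_jacobson f)

theorem topMap_topMk {e e' : R} (f : rightIdeal e →ₗ[Rᵐᵒᵖ] rightIdeal e') (x : rightIdeal e) :
    topMap f (topMk e x) = topMk e' (f x) := rfl

theorem topModule_hom_ext {e : R} {M : Type u} [AddCommGroup M] [Module Rᵐᵒᵖ M]
    {f g : topModule e →ₗ[Rᵐᵒᵖ] M} (h : ∀ x, f (topMk e x) = g (topMk e x)) : f = g := by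
  refine LinearMap.ext fun x => ?_
  obtain ⟨y, rfl⟩ := topMk_surjective e x
  exact h y

/-- Left multiplication as a map between right ideals generated by idempotents. -/
def mulLeftMap {e e' : R} (he' : IsIdempotentElem e') (c : R) (hc : e' * c = c) :
    rightIdeal e →ₗ[Rᵐᵒᵖ] rightIdeal e' where
  toFun x := ⟨c * x.1, by rw [FixedPart.mem_rightIdeal_iff he', ← mul_assoc, hc]⟩
  map_add' x y := Subtype.ext (mul_add _ _ _)
  map_smul' a x := Subtype.ext (mul_assoc _ _ _).symm

namespace IsLocalFamily

variable {n : ℕ} {ε : Fin n → R} (h : IsLocalFamily ε) {I : Finset (Fin n)} {e : R}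
  (he : e = ∑ i ∈ I, ε i)

include h he

theorem mul_sum_of_mem {i : Fin n} (hi : i ∈ I) : ε i * e = ε i := by
  classical
  rw [he, h.complete.mul_sum_of_mem hi]

theorem sum_mul_of_mem {i : Fin n} (hi : i ∈ I) : e * ε i = ε i := by
  rw [he, Finset.sum_mul, Finset.sum_eq_single_of_mem i hi, (h.complete.idem i).eq]
  intro j _ hj
  exact h.complete.ortho hj

theorem isIdempotentElem_sum : IsIdempotentElem e := by
  rw [he]
  exact h.complete.isIdempotentElem_sum

/-- `S_e` is the direct sum of the simple modules `S_i`, `i ∈ I`. -/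
theorem exists_top_decomposition :
    ∃ (a : ∀ i : Fin n, topModule (ε i) →ₗ[Rᵐᵒᵖ] topModule e)
      (b : ∀ i : Fin n, topModule e →ₗ[Rᵐᵒᵖ] topModule (ε i)),
      (∀ i ∈ I, b i ∘ₗ a i = LinearMap.id) ∧
      (∀ i ∈ I, ∀ j ∈ I, i ≠ j → b j ∘ₗ a i = 0) ∧
      ∑ i ∈ I, a i ∘ₗ b i = LinearMap.id := by
  have hee := h.isIdempotentElem_sum he
  have hmem : ∀ {c : R} (_ : IsIdempotentElem c) (x : rightIdeal c), c * x.1 = x.1 :=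
    fun hc x => (FixedPart.mem_rightIdeal_iff hc).1 x.2
  -- For `i ∈ I` left multiplication by `e` is the inclusion of ε_i R in eR; in this form it is
  -- defined for every `i`.
  let a : ∀ i : Fin n, rightIdeal (ε i) →ₗ[Rᵐᵒᵖ] rightIdeal e := fun i =>
    mulLeftMap hee e hee.eq
  let b : ∀ i : Fin n, rightIdeal e →ₗ[Rᵐᵒᵖ] rightIdeal (ε i) := fun i =>
    mulLeftMap (h.complete.idem i) (ε i) (h.complete.idem i).eq
  refine ⟨fun i => topMap (a i), fun i => topMap (b i), fun i hi => ?_, fun i hi j hj hij => ?_, ?_⟩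
  · refine topModule_hom_ext fun x => ?_
    rw [LinearMap.comp_apply, topMap_topMk, topMap_topMk]
    refine congrArg (topMk (ε i)) ?_
    refine Subtype.ext ?_
    change ε i * (e * x.1) = x.1
    rw [← mul_assoc, h.mul_sum_of_mem he hi, hmem (h.complete.idem i)]
  · refine topModule_hom_ext fun x => ?_
    rw [LinearMap.comp_apply, topMap_topMk, topMap_topMk]
    have : b j (a i x) = 0 := by
      refine Subtype.ext ?_
      change ε j * (e * x.1) = 0
      rw [← hmem (h.complete.idem i) x, ← mul_assoc e, h.sum_mul_of_mem he hi, ← mul_assoc,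
        h.complete.ortho hij.symm, zero_mul]
    rw [this, map_zero, LinearMap.zero_apply]
  · refine topModule_hom_ext fun x => ?_
    rw [LinearMap.sum_apply]
    simp only [LinearMap.comp_apply, topMap_topMk]
    rw [← map_sum]
    refine congrArg (topMk e) ?_
    refine Subtype.ext ?_
    rw [AddSubmonoidClass.coe_finsetSum]
    change ∑ i ∈ I, e * (ε i * x.1) = x.1
    rw [← Finset.mul_sum, ← Finset.sum_mul, ← he, hmem hee, hmem hee]

end IsLocalFamily

end Top

/-! ### Modules over a quotient ring -/

section Quotient

/-- `M` is a quotient of a power of A / ker φ, whose submodules correspond to the left ideals of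
`B`. -/
theorem isArtinian_of_surjective_ringHom {A B : Type u} [Ring A] [Ring B] (φ : A →+* B)
    (hφ : Function.Surjective φ) (hB : IsArtinianRing B) {M : Type u} [AddCommGroup M]
    [Module A M] (hM : Module.Finite A M) (hker : ∀ a, φ a = 0 → ∀ x : M, a • x = 0) :
    IsArtinian A M := by
  have : RingHomSurjective φ := ⟨hφ⟩
  let K : Submodule A A := LinearMap.ker φ.toSemilinearMap
  let ψ : (A ⧸ K) →ₛₗ[φ] B := K.liftQ φ.toSemilinearMap le_rfl
  have hψ : Function.Bijective ψ := by
    refine ⟨LinearMap.ker_eq_bot.1 (K.ker_liftQ_eq_bot _ _ le_rfl), fun b => ?_⟩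
    obtain ⟨a, rfl⟩ := hφ b
    exact ⟨K.mkQ a, rfl⟩
  have : IsArtinian A (A ⧸ K) := (LinearMap.isArtinian_iff_of_bijective ψ hψ).2 hB
  obtain ⟨n, s, hs⟩ := Module.Finite.exists_fin (R := A) (M := M)
  let g : (Fin n → A ⧸ K) →ₗ[A] M := ∑ i, (K.liftQ (LinearMap.toSpanSingleton A M (s i))
    (fun a ha => hker a ha (s i))) ∘ₗ LinearMap.proj i
  refine isArtinian_of_surjective _ g ?_
  rw [← LinearMap.range_eq_top, eq_top_iff, ← hs, Submodule.span_le]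
  rintro _ ⟨i, rfl⟩
  refine ⟨Pi.single i (K.mkQ 1), ?_⟩
  simp only [g, LinearMap.sum_apply, LinearMap.comp_apply, LinearMap.proj_apply]
  rw [Finset.sum_eq_single_of_mem i (Finset.mem_univ i)]
  · rw [Pi.single_eq_same]
    exact one_smul A (s i)
  · intro j _ hj
    rw [Pi.single_eq_of_ne hj, map_zero]

theorem isArtinian_of_quotientByElement {R : Type u} [Ring R] {c : R}
    (hart : IsArtinianRing (QuotientByElement c)ᵐᵒᵖ) {M : Type u} [AddCommGroup M]
    [Module Rᵐᵒᵖ M] (hM : Module.Finite Rᵐᵒᵖ M) (hc : ∀ x : M, op c • x = 0) :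
    IsArtinian Rᵐᵒᵖ M := by
  -- The annihilator of `M` is a two-sided ideal containing `c`, hence contains the ideal generated
  -- by `c`.
  let T : TwoSidedIdeal R := TwoSidedIdeal.mk' {r | ∀ x : M, op r • x = 0}
    (fun x => by rw [op_zero, zero_smul])
    (fun ha hb x => by rw [MulOpposite.op_add, add_smul, ha, hb, add_zero])
    (fun ha x => by rw [MulOpposite.op_neg, neg_smul, ha, neg_zero])
    (fun {a b} hb x => by rw [op_mul, mul_smul, hb])
    (fun {a b} ha x => by rw [op_mul, mul_smul, ha, smul_zero])
  refine isArtinian_of_surjective_ringHom (RingHom.op (TwoSidedIdeal.span {c}).ringCon.mk') ?_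
    hart hM fun a ha x => ?_
  · intro b
    obtain ⟨r, hr⟩ := RingCon.mk'_surjective (TwoSidedIdeal.span {c}).ringCon (unop b)
    exact ⟨op r, unop_injective hr⟩
  · have h0 : (TwoSidedIdeal.span {c}).ringCon.mk' (unop a) = 0 := op_injective ha
    have hmem : unop a ∈ TwoSidedIdeal.span {c} := by
      rw [TwoSidedIdeal.mem_iff]
      exact (RingCon.eq _).1 h0
    have hle : TwoSidedIdeal.span {c} ≤ T := TwoSidedIdeal.span_le.2 (by
      rintro _ rfl
      exact (TwoSidedIdeal.mem_mk' _ _ _ _ _ _ _).2 hc)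
    exact (TwoSidedIdeal.mem_mk' _ _ _ _ _ _ _).1 (hle hmem) x

end Quotient

end

section

open MulOpposite

/-! ### Directedness of the extensions between the simple modules -/

namespace IsLocalFamily

variable {R : Type u} [Ring R] {n : ℕ} {ε : Fin n → R} (h : IsLocalFamily ε) {I : Finset (Fin n)}
  {e : R} (he : e = ∑ i ∈ I, ε i)

instance (i : Fin n) : Module.Finite Rᵐᵒᵖ (topModule (ε i)) :=
  have : Module.Finite Rᵐᵒᵖ (rightIdeal (ε i)) := Module.Finite.span_singleton Rᵐᵒᵖ (ε i)
  Module.Finite.of_surjective (topMk (ε i)) (topMk_surjective (ε i))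

include h he

theorem sum_subset_mul {I' : Finset (Fin n)} (hI' : I' ⊆ I) : (∑ i ∈ I', ε i) * e = ∑ i ∈ I', ε i := by
  rw [Finset.sum_mul]
  exact Finset.sum_congr rfl fun i hi => h.mul_sum_of_mem he (hI' hi)

theorem mul_sum_subset {I' : Finset (Fin n)} (hI' : I' ⊆ I) : e * (∑ i ∈ I', ε i) = ∑ i ∈ I', ε i := by
  rw [Finset.mul_sum]
  exact Finset.sum_congr rfl fun i hi => h.sum_mul_of_mem he (hI' hi)

theorem exists_isApproximated [IsNoetherianRing Rᵐᵒᵖ]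
    (hgl : ∀ (e' : R) (he' : IsIdempotentElem e'), e' * e = e' → e * e' = e' →
      FiniteRightGlobalDimension (IdempotentSubring he')) {I' : Finset (Fin n)} (hI' : I' ⊆ I)
    (M : ModuleCat.{u} Rᵐᵒᵖ) (hM : Module.Finite Rᵐᵒᵖ M) :
    ∃ l, IsApproximated (∑ i ∈ I', h.localSystem.ε i) M l := by
  have he' : IsIdempotentElem (∑ i ∈ I', ε i) := h.isIdempotentElem_sum rfl
  obtain ⟨N, hN⟩ := hgl _ he' (h.sum_subset_mul he hI') (h.mul_sum_subset he hI')
  obtain ⟨l, hl⟩ := IsApproximated.exists_of_hasProjectiveDimensionLE he'.one_sub N M hM (hN _)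
  refine ⟨l, ?_⟩
  rw [sub_sub_cancel, Finset.op_sum] at hl
  exact hl

theorem isFiniteLength_of_supported [IsNoetherianRing Rᵐᵒᵖ]
    (hart : IsArtinianRing (QuotientByElement (1 - e))ᵐᵒᵖ) {I' : Finset (Fin n)} (hI' : I' ⊆ I)
    (M : ModuleCat.{u} Rᵐᵒᵖ) (hM : Module.Finite Rᵐᵒᵖ M) (hs : h.localSystem.Supported I' M) :
    IsFiniteLength Rᵐᵒᵖ M := by
  rw [isFiniteLength_iff_isNoetherian_isArtinian]
  refine ⟨inferInstance, isArtinian_of_quotientByElement hart hM fun x => ?_⟩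
  have hx : op (∑ i ∈ I', ε i) • x = x := by
    rw [Finset.op_sum]
    exact hs x
  rw [← hx, smul_smul, ← op_mul, mul_sub, mul_one, h.sum_subset_mul he hI', sub_self, op_zero,
    zero_smul]

theorem ext_directed [IsNoetherianRing Rᵐᵒᵖ]
    (hart : IsArtinianRing (QuotientByElement (1 - e))ᵐᵒᵖ)
    (hgl : ∀ (e' : R) (he' : IsIdempotentElem e'), e' * e = e' → e * e' = e' →
      FiniteRightGlobalDimension (IdempotentSubring he')) :
    (∃ l : List (Fin n), l.Nodup ∧ l.toFinset = I ∧
      l.Pairwise fun a b => ∀ k, Subsingleton (Ext (topModule (ε a)) (topModule (ε b)) k)) ∧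
    (∀ a ∈ I, ∀ k, Subsingleton (Ext (topModule (ε a)) (topModule (ε a)) (k + 1))) ∧
    ∃ N, ∀ a ∈ I, ∀ (Y : ModuleCat.{u} Rᵐᵒᵖ) (k : ℕ), N < k →
      Subsingleton (Ext (topModule (ε a)) Y k) := by
  have hbd : ∀ a, ∃ N, ∀ (Y : ModuleCat.{u} Rᵐᵒᵖ) (k : ℕ), N < k →
      Subsingleton (Ext (topModule (ε a)) Y k) := by
    intro a
    -- For the empty subset e' = 0 and Γ_{e'} is `R` itself, so the approximation is a finite
    -- projective resolution.
    obtain ⟨l, hl⟩ := h.exists_isApproximated he hgl (Finset.empty_subset I) (topModule (ε a))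
      inferInstance
    exact ⟨l.length, fun Y k hk => hl.subsingleton_ext_of_length_lt Finset.sum_empty Y k hk⟩
  obtain ⟨h₁, h₂⟩ := LocalSystem.exists_directed_list (L := h.localSystem) (I := I)
    (fun I' hI' M hM hs => h.isFiniteLength_of_supported he hart hI' M hM hs)
    (fun a _ => hbd a)
    (fun I' hI' a _ => h.exists_isApproximated he hgl hI' _ (h.localSystem.finite a))
  refine ⟨h₁, h₂, ?_⟩
  choose N hN using hbd
  exact ⟨∑ a, N a, fun a _ Y k hk => hN a Y k
    (lt_of_le_of_lt (Finset.single_le_sum (fun _ _ => Nat.zero_le _) (Finset.mem_univ a)) hk)⟩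

end IsLocalFamily

end

/-! ### Global dimension of triangular rings -/

/-- The corner ring `eAe` is a skew field. -/
structure IsDivisionCorner {A : Type u} [Ring A] (e : A) : Prop where
  idem : IsIdempotentElem e
  ne_zero : e ≠ 0
  exists_inv : ∀ a, e * a * e ≠ 0 → ∃ b, e * b * e * (e * a * e) = e ∧ e * a * e * (e * b * e) = e

namespace IsDivisionCorner

variable {A : Type u} [Ring A] {e : A} (h : IsDivisionCorner e)

include h

theorem nontrivial_corner (he : IsIdempotentElem e) : Nontrivial he.Corner :=
  ⟨⟨0, 1, fun h' => h.ne_zero (congrArg Subtype.val h').symm⟩⟩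

theorem isUnit_corner (he : IsIdempotentElem e) (x : he.Corner) (hx : x ≠ 0) : IsUnit x := by
  obtain ⟨_, a, rfl⟩ := x
  obtain ⟨b, hb₁, hb₂⟩ := h.exists_inv a fun h0 => hx (Subtype.ext h0)
  exact ⟨⟨⟨_, a, rfl⟩, ⟨_, b, rfl⟩, Subtype.ext hb₂, Subtype.ext hb₁⟩, rfl⟩

theorem isPrimitiveIdempotent : IsPrimitiveIdempotent e := by
  refine ⟨h.idem, h.ne_zero, fun a b ha hb hab hba hsum => ?_⟩
  have hea : e * a * e = a := by
    rw [← hsum, add_mul, ha.eq, hba, add_zero, mul_add, ha.eq, hab, add_zero]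
  by_cases ha0 : a = 0
  · exact Or.inl ha0
  · right
    obtain ⟨c, -, hc⟩ := h.exists_inv a (by rwa [hea])
    rw [hea] at hc
    calc b = b * e := by rw [← hsum, mul_add, hba, zero_add, hb.eq]
      _ = b * (a * (e * c * e)) := by rw [hc]
      _ = b * a * (e * c * e) := (mul_assoc _ _ _).symm
      _ = 0 := by rw [hba, zero_mul]

theorem op : IsDivisionCorner (MulOpposite.op e) := by
  refine ⟨congrArg MulOpposite.op h.idem.eq, fun h0 => h.ne_zero (MulOpposite.op_injective h0),
    fun a ha => ?_⟩
  obtain ⟨b, hb₁, hb₂⟩ := h.exists_inv (MulOpposite.unop a) fun h0 => ha (by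
    refine MulOpposite.unop_injective ?_
    simpa [mul_assoc] using h0)
  refine ⟨MulOpposite.op b, MulOpposite.unop_injective ?_, MulOpposite.unop_injective ?_⟩
  · simpa [mul_assoc] using hb₂
  · simpa [mul_assoc] using hb₁

/-- The division ring structure on the corner. -/
@[reducible]
noncomputable def divisionRing : DivisionRing h.idem.Corner :=
  have := h.nontrivial_corner h.idem
  DivisionRing.ofIsUnitOrEqZero fun x =>
    (em (x = 0)).symm.imp_left (h.isUnit_corner h.idem x)

end IsDivisionCorner

section Triangular

variable {A : Type u} [Ring A]

/-- A module fixed by an idempotent as a module over the corner ring. -/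
@[reducible]
def cornerModule {e : A} (he : IsIdempotentElem e) (M : Type u) [AddCommGroup M] [Module A M]
    (hM : ∀ x : M, e • x = x) : Module he.Corner M where
  smul c x := c.1 • x
  one_smul x := hM x
  mul_smul a b x := mul_smul a.1 b.1 x
  smul_zero a := smul_zero a.1
  smul_add a x y := smul_add a.1 x y
  add_smul a b x := add_smul a.1 b.1 x
  zero_smul x := zero_smul A x

/-- A module fixed by an idempotent with division corner is a quotient of a projective module
by a submodule that is annihilated by the idempotent. -/
theorem IsDivisionCorner.exists_presentation {e : A} (h : IsDivisionCorner e) (M : Type u)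
    [AddCommGroup M] [Module A M] (hM : ∀ x : M, e • x = x) :
    ∃ (κ : Type u) (g : (κ →₀ Ideal.span {e}) →ₗ[A] M), Function.Surjective g ∧
      ∀ z, g z = 0 → e • z = 0 := by
  let _ := h.divisionRing
  let _ := cornerModule h.idem M hM
  -- `M` is a vector space over the skew field eAe; each basis vector receives one copy of Ae.
  let κ := Module.Basis.ofVectorSpaceIndex h.idem.Corner M
  let b : Module.Basis κ h.idem.Corner M := Module.Basis.ofVectorSpace h.idem.Corner M
  let g : (κ →₀ Ideal.span {e}) →ₗ[A] M :=
    Finsupp.lsum ℕ fun k => LinearMap.toSpanSingleton A M (b k) ∘ₗ (Ideal.span {e}).subtype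
  have hmem : ∀ y : Ideal.span {e}, y.1 * e = y.1 := by
    intro y
    obtain ⟨a, ha⟩ := Ideal.mem_span_singleton'.1 y.2
    rw [← ha, mul_assoc, h.idem.eq]
  have hg : ∀ z, g z = z.sum fun k y => y.1 • b k := fun _ => rfl
  let φ : h.idem.Corner → Ideal.span {e} := fun d => ⟨d.1, Ideal.mem_span_singleton'.2
    ⟨d.1, ((Subsemigroup.mem_corner_iff h.idem).1 d.2).2⟩⟩
  let ψ : Ideal.span {e} → h.idem.Corner := fun y => ⟨e * y.1, (Subsemigroup.mem_corner_iff h.idem).2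
    ⟨by rw [← mul_assoc, h.idem.eq], by rw [mul_assoc, hmem]⟩⟩
  have hφ : φ 0 = 0 := rfl
  have hψ : ψ 0 = 0 := Subtype.ext (mul_zero e)
  refine ⟨κ, g, fun x => ⟨(b.repr x).mapRange φ hφ, ?_⟩, fun z hz => ?_⟩
  · conv_rhs => rw [← b.linearCombination_repr x]
    rw [Finsupp.linearCombination_apply, hg]
    exact Finsupp.sum_mapRange_index (h := fun k (y : Ideal.span {e}) => y.1 • b k) (fun _ => zero_smul A _)
  -- Applying `e` to `g z = 0` gives a linear relation over eAe between basis vectors, with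
  -- coefficients the components of `e • z`.
  · have hc : Finsupp.linearCombination h.idem.Corner b (z.mapRange ψ hψ) = 0 := by
      rw [Finsupp.linearCombination_apply]
      refine (Finsupp.sum_mapRange_index (h := fun k d => d • b k) (fun _ => zero_smul _ _)).trans ?_
      calc (z.sum fun k y => ψ y • b k) = z.sum fun k y => e • (y.1 • b k) :=
            Finsupp.sum_congr fun k _ => mul_smul e _ _
        _ = e • g z := by rw [hg, Finsupp.smul_sum]
        _ = 0 := by rw [hz, smul_zero]
    have hc0 := linearIndependent_iff.1 b.linearIndependent _ hc
    refine Finsupp.ext fun k => Subtype.ext ?_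
    exact congrArg (fun d : h.idem.Corner => d.1) (DFunLike.congr_fun hc0 k)

theorem projective_finsupp_span {e : A} (he : IsIdempotentElem e) (κ : Type u) :
    Module.Projective A (κ →₀ Ideal.span {e}) := by
  let r : A →ₗ[A] Ideal.span {e} :=
    { toFun a := ⟨a * e, Ideal.mem_span_singleton'.2 ⟨a, rfl⟩⟩
      map_add' a b := Subtype.ext (add_mul _ _ _)
      map_smul' a b := Subtype.ext (mul_assoc _ _ _) }
  refine Module.Projective.of_split (M := κ →₀ A)
    (Finsupp.mapRange.linearMap (Ideal.span {e}).subtype) (Finsupp.mapRange.linearMap r) ?_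
  have hr : ∀ y : Ideal.span {e}, r y.1 = y := by
    intro y
    obtain ⟨a, ha⟩ := Ideal.mem_span_singleton'.1 y.2
    refine Subtype.ext ?_
    change y.1 * e = y.1
    rw [← ha, mul_assoc, he.eq]
  exact LinearMap.ext fun f => Finsupp.ext fun k => hr (f k)

/-- Let i₀ = n - (k + 1) be the first vertex at which `M` may be nonzero. By triangularity the
elements killed by ε_{i₀} form a submodule `N`, and M/N is a quotient of copies of Aε_{i₀} with
kernel also living at later vertices. Induction applies to `N` and to that kernel. At k = n no
condition on `M` remains. -/
theorem hasProjectiveDimensionLT_of_triangular {n : ℕ} {ε : Fin n → A}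
    (hε : CompleteOrthogonalIdempotents ε) (hdiv : ∀ i, IsDivisionCorner (ε i))
    (htri : ∀ i j, i < j → ∀ a, ε i * a * ε j = 0) (k : ℕ) (M : ModuleCat.{u} A)
    (hM : ∀ i : Fin n, i.1 + k < n → ∀ x : M, ε i • x = 0) : HasProjectiveDimensionLT M k := by
  classical
  have hsum : ∀ {M : Type u} [AddCommGroup M] [Module A M] (a : A) (x : M),
      a • x = ∑ j, (a * ε j) • x := by
    intro M _ _ a x
    rw [← Finset.sum_smul, ← Finset.mul_sum, hε.complete, mul_one]
  induction k generalizing M with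
  | zero =>
    have : Subsingleton M := subsingleton_of_forall_eq 0 fun x => by
      rw [← one_smul A x, hsum]
      refine Finset.sum_eq_zero fun j _ => ?_
      rw [one_mul, hM j (by simp)]
    exact (ModuleCat.isZero_of_subsingleton M).hasProjectiveDimensionLT_zero
  | succ k ih =>
    by_cases hk : k < n
    swap
    · have := ih M fun i hi => by lia
      exact hasProjectiveDimensionLT_of_ge M k (k + 1) (by lia)
    let i₀ : Fin n := ⟨n - (k + 1), by lia⟩
    have hi₀ : ∀ i : Fin n, i < i₀ → ∀ x : M, ε i • x = 0 := fun i hi =>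
      hM i (by
        have : i.1 < n - (k + 1) := hi
        lia)
    have hlt : ∀ i : Fin n, i.1 + k < n → i < i₀ ∨ i = i₀ := by
      intro i hi
      rcases lt_or_eq_of_le (show i.1 ≤ n - (k + 1) by lia) with h | h
      · exact Or.inl h
      · exact Or.inr (Fin.ext h)
    have hid : ε i₀ * ε i₀ = ε i₀ := (hε.idem i₀).eq
    let N : Submodule A M :=
      { carrier := {x | ε i₀ • x = 0}
        add_mem' {x y} hx hy := by
          change ε i₀ • (x + y) = 0
          rw [smul_add, hx, hy, add_zero]
        zero_mem' := smul_zero _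
        smul_mem' a x hx := by
          change ε i₀ • a • x = 0
          rw [smul_smul, hsum]
          refine Finset.sum_eq_zero fun j _ => ?_
          rcases lt_trichotomy j i₀ with hj | hj | hj
          · rw [mul_smul, hi₀ j hj, smul_zero]
          · rw [hj, mul_smul, hx, smul_zero]
          · rw [htri i₀ j hj, zero_smul] }
    have hN : HasProjectiveDimensionLT (ModuleCat.of A N) k := by
      refine ih _ fun i hi x => Subtype.ext ?_
      rcases hlt i hi with h | rfl
      · exact hi₀ i h x.1
      · exact x.2
    have hQ : ∀ x : M ⧸ N, ε i₀ • x = x := by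
      intro x
      obtain ⟨x, rfl⟩ := N.mkQ_surjective x
      rw [← sub_eq_zero, ← map_smul, ← map_sub]
      refine (Submodule.Quotient.mk_eq_zero N).2 ?_
      change ε i₀ • (ε i₀ • x - x) = 0
      rw [smul_sub, smul_smul, hid, sub_self]
    obtain ⟨κ, g, hg, hgK⟩ := (hdiv i₀).exists_presentation (M ⧸ N) hQ
    have hproj := projective_finsupp_span (hε.idem i₀) κ
    have hK : HasProjectiveDimensionLT (ModuleCat.of A (LinearMap.ker g)) k := by
      refine ih _ fun i hi x => Subtype.ext ?_
      rcases hlt i hi with h | rfl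
      · refine Finsupp.ext fun k' => Subtype.ext ?_
        change ε i * (x.1 k').1 = 0
        obtain ⟨a, ha⟩ := Ideal.mem_span_singleton'.1 (x.1 k').2
        rw [← ha, ← mul_assoc, htri i i₀ h]
      · exact hgK x.1 x.2
    have hF : Projective (ModuleCat.of A (κ →₀ Ideal.span {ε i₀})) :=
      (IsProjective.iff_projective _).1 hproj
    have hS := exactPair_shortExact (M₁ := ModuleCat.of A (LinearMap.ker g))
      (M₂ := ModuleCat.of A (κ →₀ Ideal.span {ε i₀})) (M₃ := ModuleCat.of A (M ⧸ N))
      (LinearMap.exact_subtype_ker_map g) (LinearMap.ker g).injective_subtype hg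
    have hQpd := hS.hasProjectiveDimensionLT_X₃ k hK inferInstance
    have hS' := exactPair_shortExact (M₁ := ModuleCat.of A N)
      (M₂ := M) (M₃ := ModuleCat.of A (M ⧸ N))
      (LinearMap.exact_subtype_mkQ N) N.injective_subtype N.mkQ_surjective
    exact hS'.hasProjectiveDimensionLT_X₂ (k + 1)
      (hasProjectiveDimensionLT_of_ge _ k (k + 1) (by lia)) hQpd

theorem finiteLeftGlobalDimension_of_triangular {n : ℕ} {ε : Fin n → A}
    (hε : CompleteOrthogonalIdempotents ε) (hdiv : ∀ i, IsDivisionCorner (ε i))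
    (htri : ∀ i j, i < j → ∀ a, ε i * a * ε j = 0) : FiniteLeftGlobalDimension A :=
  ⟨n, fun M => by
    have := hasProjectiveDimensionLT_of_triangular hε hdiv htri n M fun i hi => by lia
    exact hasProjectiveDimensionLT_of_ge M n (n + 1) (by lia)⟩

/-- Passing to the opposite ring reverses the triangular shape, so the idempotents are numbered
backwards. -/
theorem finiteRightGlobalDimension_of_triangular {n : ℕ} {ε : Fin n → A}
    (hε : CompleteOrthogonalIdempotents ε) (hdiv : ∀ i, IsDivisionCorner (ε i))
    (htri : ∀ i j, i < j → ∀ a, ε i * a * ε j = 0) : FiniteRightGlobalDimension A := by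
  refine finiteLeftGlobalDimension_of_triangular (A := Aᵐᵒᵖ)
    (ε := fun i => MulOpposite.op (ε i.rev)) ⟨⟨fun i => ?_, fun i j hij => ?_⟩, ?_⟩
    (fun i => (hdiv i.rev).op) fun i j hij a => ?_
  · exact congrArg MulOpposite.op (hε.idem i.rev).eq
  · exact congrArg MulOpposite.op (hε.ortho fun h => hij (Fin.rev_injective h).symm)
  · rw [← Finset.op_sum, show ∑ i : Fin n, ε i.rev = ∑ i, ε i from Equiv.sum_comp Fin.revPerm ε]
    exact congrArg MulOpposite.op hε.complete
  · refine MulOpposite.unop_injective ?_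
    have := htri j.rev i.rev (Fin.rev_lt_rev.2 hij) (MulOpposite.unop a)
    simpa [mul_assoc] using this

end Triangular

/-! ### Idempotents in the Yoneda ring of a direct sum -/

section YonedaIdempotents

variable {C : Type*} [Category.{u} C] [Abelian C] [HasExt.{u} C] {X : C}

/-- The inclusion of a homogeneous component into the Yoneda ring. -/
noncomputable abbrev yonedaOf {k : ℕ} (α : Ext X X k) : YonedaRing X :=
  DirectSum.of (fun n => Ext X X n) k α

theorem yonedaOf_mul {i j m : ℕ} (α : Ext X X i) (β : Ext X X j) (h : i + j = m) :
    yonedaOf α * yonedaOf β = yonedaOf (α.comp β h) := by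
  subst h
  exact DirectSum.of_mul_of _ _

theorem yonedaOf_zero {k : ℕ} : yonedaOf (0 : Ext X X k) = 0 := map_zero _

theorem yonedaOf_mk₀_mul (f g : X ⟶ X) :
    yonedaOf (Ext.mk₀ f) * yonedaOf (Ext.mk₀ g) = yonedaOf (Ext.mk₀ (f ≫ g)) := by
  rw [yonedaOf_mul _ _ (zero_add 0), Ext.mk₀_comp_mk₀]

theorem yonedaOf_mk₀_mul_mul {k : ℕ} (f g : X ⟶ X) (α : Ext X X k) :
    yonedaOf (Ext.mk₀ f) * yonedaOf α * yonedaOf (Ext.mk₀ g) =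
      yonedaOf (((Ext.mk₀ f).comp α (zero_add k)).comp (Ext.mk₀ g) (add_zero k)) := by
  rw [yonedaOf_mul _ _ (zero_add k), yonedaOf_mul _ _ (add_zero k)]

variable {n : ℕ} {S : Fin n → C} {a : ∀ i, S i ⟶ X} {b : ∀ i, X ⟶ S i}

/-- The sandwiched class factors through Ext^k(S_i, S_j); this is how the blocks of the Yoneda ring
are compared with extensions of the summands. -/
theorem yonedaOf_idempotent_sandwich (i j : Fin n) {k : ℕ} (α : Ext X X k) :
    yonedaOf (Ext.mk₀ (b i ≫ a i)) * yonedaOf α * yonedaOf (Ext.mk₀ (b j ≫ a j)) =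
      yonedaOf ((Ext.mk₀ (b i)).comp ((((Ext.mk₀ (a i)).comp α (zero_add k)).comp
        (Ext.mk₀ (b j)) (add_zero k)).comp (Ext.mk₀ (a j)) (add_zero k)) (zero_add k)) := by
  rw [yonedaOf_mk₀_mul_mul, ← Ext.mk₀_comp_mk₀, ← Ext.mk₀_comp_mk₀]
  congr 1
  simp only [Ext.comp_assoc_of_second_deg_zero, Ext.comp_assoc_of_third_deg_zero, Ext.mk₀_comp_mk₀,
    Ext.mk₀_comp_mk₀_assoc]

/-- The idempotents of the Yoneda ring attached to a decomposition of the object. -/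
theorem yoneda_completeOrthogonalIdempotents (hid : ∀ i, a i ≫ b i = 𝟙 (S i))
    (hort : ∀ i j, i ≠ j → a i ≫ b j = 0) (hsum : ∑ i, b i ≫ a i = 𝟙 X) :
    CompleteOrthogonalIdempotents fun i => yonedaOf (Ext.mk₀ (b i ≫ a i)) := by
  refine ⟨⟨fun i => ?_, fun i j hij => ?_⟩, ?_⟩
  · change yonedaOf _ * yonedaOf _ = yonedaOf _
    rw [yonedaOf_mk₀_mul, Category.assoc, reassoc_of% hid i]
  · change yonedaOf _ * yonedaOf _ = 0
    rw [yonedaOf_mk₀_mul, Category.assoc, ← Category.assoc (a i), hort i j hij, Limits.zero_comp,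
      Limits.comp_zero, Ext.mk₀_zero, yonedaOf_zero]
  · rw [← map_sum, ← Ext.mk₀_sum, hsum]
    rfl

theorem yoneda_sandwich_eq_zero {i j : Fin n}
    (h : ∀ k, Subsingleton (Ext (S i) (S j) k)) (y : YonedaRing X) :
    yonedaOf (Ext.mk₀ (b i ≫ a i)) * y * yonedaOf (Ext.mk₀ (b j ≫ a j)) = 0 := by
  induction y using DirectSum.induction_on with
  | zero => rw [mul_zero, zero_mul]
  | of k α =>
    have := h k
    refine (yonedaOf_idempotent_sandwich i j α).trans ?_
    rw [Subsingleton.elim (((Ext.mk₀ (a i)).comp α (zero_add k)).comp (Ext.mk₀ (b j)) (add_zero k)) 0,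
      Ext.zero_comp, Ext.comp_zero, yonedaOf_zero]
  | add x y hx hy => rw [mul_add, add_mul, hx, hy, add_zero]

theorem yoneda_sandwich_eq {i : Fin n}
    (h : ∀ k, Subsingleton (Ext (S i) (S i) (k + 1))) (y : YonedaRing X) :
    ∃ φ : S i ⟶ S i, yonedaOf (Ext.mk₀ (b i ≫ a i)) * y * yonedaOf (Ext.mk₀ (b i ≫ a i)) =
      yonedaOf (Ext.mk₀ (b i ≫ φ ≫ a i)) := by
  induction y using DirectSum.induction_on with
  | zero =>
    refine ⟨0, ?_⟩
    rw [mul_zero, zero_mul, Limits.zero_comp, Limits.comp_zero, Ext.mk₀_zero, yonedaOf_zero]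
  | of k α =>
    cases k with
    | zero =>
      obtain ⟨f, rfl⟩ := (Ext.mk₀_bijective _ _).2 α
      refine ⟨a i ≫ f ≫ b i, ?_⟩
      change yonedaOf _ * yonedaOf _ * yonedaOf _ = _
      rw [yonedaOf_mk₀_mul, yonedaOf_mk₀_mul]
      simp only [Category.assoc]
    | succ k =>
      refine ⟨0, ?_⟩
      have := h k
      refine (yonedaOf_idempotent_sandwich i i α).trans ?_
      rw [Subsingleton.elim (((Ext.mk₀ (a i)).comp α (zero_add (k + 1))).comp (Ext.mk₀ (b i))
        (add_zero (k + 1))) 0, Ext.zero_comp, Ext.comp_zero, yonedaOf_zero, Limits.zero_comp,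
        Limits.comp_zero, Ext.mk₀_zero, yonedaOf_zero]
  | add x y hx hy =>
    obtain ⟨φ, hφ⟩ := hx
    obtain ⟨ψ, hψ⟩ := hy
    refine ⟨φ + ψ, ?_⟩
    rw [mul_add, add_mul, hφ, hψ, Preadditive.add_comp, Preadditive.comp_add, Ext.mk₀_add]
    exact (map_add _ _ _).symm

/-- Without self-extensions the corner consists of the endomorphisms of S_i, and Schur's lemma
applies. -/
theorem yoneda_isDivisionCorner (hid : ∀ i, a i ≫ b i = 𝟙 (S i)) {i : Fin n} [Simple (S i)]
    (h : ∀ k, Subsingleton (Ext (S i) (S i) (k + 1))) :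
    IsDivisionCorner (yonedaOf (Ext.mk₀ (b i ≫ a i))) := by
  have hmul : ∀ φ ψ : S i ⟶ S i, yonedaOf (Ext.mk₀ (b i ≫ φ ≫ a i)) *
      yonedaOf (Ext.mk₀ (b i ≫ ψ ≫ a i)) = yonedaOf (Ext.mk₀ (b i ≫ (φ ≫ ψ) ≫ a i)) := by
    intro φ ψ
    rw [yonedaOf_mk₀_mul]
    simp only [Category.assoc, reassoc_of% hid i]
  have hone : b i ≫ a i = b i ≫ 𝟙 (S i) ≫ a i := by rw [Category.id_comp]
  refine ⟨?_, fun h0 => ?_, fun y hy => ?_⟩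
  · change yonedaOf _ * yonedaOf _ = yonedaOf _
    rw [hone, hmul, Category.comp_id]
  · have h1 := (Ext.mk₀_eq_zero_iff _).1 (DirectSum.of_injective 0 (h0.trans (map_zero _).symm))
    apply id_nonzero (S i)
    calc 𝟙 (S i) = (a i ≫ b i) ≫ (a i ≫ b i) := by rw [hid, Category.comp_id]
      _ = a i ≫ (b i ≫ a i) ≫ b i := by simp only [Category.assoc]
      _ = 0 := by rw [h1, Limits.zero_comp, Limits.comp_zero]
  · obtain ⟨φ, hφ⟩ := yoneda_sandwich_eq (a := a) (b := b) h y
    have hφ0 : φ ≠ 0 := by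
      rintro rfl
      apply hy
      rw [hφ, Limits.zero_comp, Limits.comp_zero, Ext.mk₀_zero, yonedaOf_zero]
    have := isIso_of_hom_simple hφ0
    have hinv : yonedaOf (Ext.mk₀ (b i ≫ a i)) * yonedaOf (Ext.mk₀ (b i ≫ inv φ ≫ a i)) *
        yonedaOf (Ext.mk₀ (b i ≫ a i)) = yonedaOf (Ext.mk₀ (b i ≫ inv φ ≫ a i)) := by
      rw [hone, hmul, hmul, Category.comp_id, Category.id_comp]
    refine ⟨yonedaOf (Ext.mk₀ (b i ≫ inv φ ≫ a i)), ?_, ?_⟩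
    · rw [hφ, hinv, hmul, IsIso.inv_hom_id, ← hone]
    · rw [hφ, hinv, hmul, IsIso.hom_inv_id, ← hone]

end YonedaIdempotents

/-! ### Artinian extension groups -/

section ArtinianExt

variable {A : Type u} [Ring A] {X : ModuleCat.{u} A}

/-- The endomorphism ring of a module acts on the groups of extensions with values in it. -/
noncomputable instance extEndModule (K : ModuleCat.{u} A) (k : ℕ) :
    Module (Module.End A X) (Ext K X k) where
  smul d α := α.comp (Ext.mk₀ (ModuleCat.ofHom d)) (add_zero k)
  one_smul α := Ext.comp_mk₀_id α
  mul_smul x y α := by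
    change α.comp (Ext.mk₀ (ModuleCat.ofHom y ≫ ModuleCat.ofHom x)) (add_zero k) =
      (α.comp (Ext.mk₀ (ModuleCat.ofHom y)) (add_zero k)).comp (Ext.mk₀ (ModuleCat.ofHom x))
        (add_zero k)
    rw [← Ext.mk₀_comp_mk₀, Ext.comp_assoc_of_third_deg_zero]
  smul_zero d := Ext.zero_comp _ _ _ _ (add_zero k)
  smul_add d α β := Ext.add_comp _ _ _ _
  add_smul x y α := by
    change α.comp (Ext.mk₀ (ModuleCat.ofHom x + ModuleCat.ofHom y)) (add_zero k) = _
    rw [Ext.mk₀_add, Ext.comp_add]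
    rfl
  zero_smul α := by
    change α.comp (Ext.mk₀ (0 : X ⟶ X)) (add_zero k) = 0
    rw [Ext.mk₀_zero, Ext.comp_zero]

theorem ext_end_smul_def {K : ModuleCat.{u} A} {k : ℕ} (d : Module.End A X) (α : Ext K X k) :
    d • α = α.comp (Ext.mk₀ (ModuleCat.ofHom d)) (add_zero k) := rfl

/-- Evaluation of an extension in degree zero at an element. -/
noncomputable def extZeroEval {K : ModuleCat.{u} A} (s : K) :
    Ext K X 0 →ₗ[Module.End A X] X where
  toFun α := (Ext.homEquiv₀ α).hom s
  map_add' α β := by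
    change (Ext.addEquiv₀ (α + β)).hom s = _
    rw [map_add]
    rfl
  map_smul' d α := by
    obtain ⟨f, rfl⟩ := (Ext.mk₀_bijective _ _).2 α
    rw [ext_end_smul_def, Ext.mk₀_comp_mk₀]
    have h : ∀ g : K ⟶ X, Ext.homEquiv₀ (Ext.mk₀ g) = g := Ext.homEquiv₀.apply_symm_apply
    rw [h, h]
    rfl

theorem extZeroEval_mk₀ {K : ModuleCat.{u} A} (s : K) (f : K ⟶ X) :
    extZeroEval s (Ext.mk₀ f) = f.hom s :=
  congrArg (fun g : K ⟶ X => g.hom s) (Ext.homEquiv₀.apply_symm_apply f)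

/-- Dimension shifting, linear over End(X). A map from `K` is determined by its values on r
generators, so Hom(K, X) embeds in X^r; for a free cover of `K` with kernel `N`, the connecting map
sends Ext^k(N, X) onto Ext^{k+1}(K, X), and `N` is again finitely generated. -/
theorem isArtinian_ext [IsNoetherianRing A] (hX : IsArtinian (Module.End A X) X) (k : ℕ)
    (K : ModuleCat.{u} A) (hK : Module.Finite A K) : IsArtinian (Module.End A X) (Ext K X k) := by
  induction k generalizing K with
  | zero =>
    obtain ⟨r, s, hs⟩ := Module.Finite.exists_fin (R := A) (M := K)
    refine isArtinian_of_injective (LinearMap.pi fun i : Fin r => extZeroEval (X := X) (s i)) ?_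
    intro α β hαβ
    obtain ⟨f, rfl⟩ := (Ext.mk₀_bijective _ _).2 α
    obtain ⟨g, rfl⟩ := (Ext.mk₀_bijective _ _).2 β
    congr 1
    ext1
    refine LinearMap.ext_on_range hs fun i => ?_
    simpa only [LinearMap.pi_apply, extZeroEval_mk₀] using congrFun hαβ i
  | succ k ih =>
    obtain ⟨r, s, hs⟩ := Module.Finite.exists_fin (R := A) (M := K)
    let F : ModuleCat.{u} A := ModuleCat.of A (Fin r → A)
    let g : F →ₗ[A] K := Fintype.linearCombination A s
    have hg : Function.Surjective g := by
      rw [← LinearMap.range_eq_top, Fintype.range_linearCombination, hs]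
    let N : ModuleCat.{u} A := ModuleCat.of A (LinearMap.ker g)
    have hF : IsNoetherian A F := inferInstanceAs (IsNoetherian A (Fin r → A))
    have hN : Module.Finite A N := inferInstanceAs (Module.Finite A (LinearMap.ker g))
    have hse := exactPair_shortExact (M₁ := N) (f := (LinearMap.ker g).subtype) (g := g)
      (LinearMap.exact_subtype_ker_map g) Subtype.val_injective hg
    have := ih N hN
    have hproj := subsingleton_ext_succ_of_projective
      (inferInstanceAs (Module.Projective A (Fin r → A)) : Module.Projective A F) X k
    let δ : Ext N X k →ₗ[Module.End A X] Ext K X (k + 1) :=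
      { toFun := fun α => hse.extClass.comp α (add_comm 1 k)
        map_add' := fun α β => Ext.comp_add _ _ _ _
        map_smul' := fun d α => by
          rw [RingHom.id_apply, ext_end_smul_def, ext_end_smul_def,
            Ext.comp_assoc_of_third_deg_zero] }
    refine isArtinian_of_surjective _ δ fun x => ?_
    exact Ext.contravariant_sequence_exact₃ hse X x (Subsingleton.elim _ _) (add_comm 1 k)

/-- Because `ε i` acts as the identity on S_i, automorphisms of S_i move any nonzero element to the
generator: S_i is one-dimensional over its endomorphism skew field. Hence `X` is a finite sum of
simple End(X)-modules. -/
theorem LocalSystem.isArtinian_end {ι : Type} (L : LocalSystem A ι) {I : Finset ι}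
    {a : ∀ i, L.S i →ₗ[A] X} {b : ∀ i, X →ₗ[A] L.S i}
    (hid : ∀ i ∈ I, b i ∘ₗ a i = LinearMap.id) (hsum : ∑ i ∈ I, a i ∘ₗ b i = LinearMap.id) :
    IsArtinian (Module.End A X) X := by
  have hba : ∀ i ∈ I, ∀ s, b i (a i s) = s := fun i hi s => LinearMap.congr_fun (hid i hi) s
  have hx : ∀ x, ∑ i ∈ I, a i (b i x) = x := fun x => by
    simpa using LinearMap.congr_fun hsum x
  have hequiv : ∀ i (s : L.S i), s ≠ 0 → ∃ φ : L.S i ≃ₗ[A] L.S i, φ s = L.q i (L.p i) := by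
    intro i s hs
    obtain ⟨φ, hφ⟩ := L.exists_equiv (L.simple i) (x := s) (by rwa [L.smul_eq_self])
    exact ⟨φ, by rwa [L.smul_eq_self] at hφ⟩
  let t : ∀ i, X := fun i => a i (L.q i (L.p i))
  let T : I → Submodule (Module.End A X) X := fun i => Submodule.span (Module.End A X) {t i}
  have hT : ∀ i, IsArtinian (Module.End A X) (T i) := by
    rintro ⟨i, hi⟩
    have hsimple : IsSimpleModule (Module.End A X) (T ⟨i, hi⟩) := by
      rw [isSimpleModule_iff_toSpanSingleton_surjective]
      refine ⟨⟨⟨⟨t i, Submodule.mem_span_singleton_self _⟩, 0, fun h => ?_⟩⟩, ?_⟩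
      · apply L.q_p_ne_zero i
        have h' : t i = 0 := congrArg Subtype.val h
        rw [← hba i hi (L.q i (L.p i))]
        exact (congrArg (b i) h').trans (map_zero _)
      · rintro ⟨z, hz⟩ hz0 ⟨y, hy⟩
        obtain ⟨c, rfl⟩ := Submodule.mem_span_singleton.1 hy
        obtain ⟨d, hd⟩ := Submodule.mem_span_singleton.1 hz
        -- Endomorphisms commute with `ε i`, so `z` is fixed by `ε i` and only its component in S_i
        -- is nonzero.
        have hεz : L.ε i • z = z := by
          rw [← hd]
          change L.ε i • d (a i (L.q i (L.p i))) = d (a i (L.q i (L.p i)))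
          rw [← map_smul, ← map_smul, L.smul_eq_self]
        have hz' : a i (b i z) = z := by
          conv_rhs => rw [← hx z]
          refine (Finset.sum_eq_single_of_mem (f := fun j => a j (b j z)) i hi ?_).symm
          intro j _ hj
          change a j (b j z) = 0
          rw [← hεz, map_smul, L.smul_eq_zero i j hj.symm, map_zero]
        obtain ⟨φ, hφ⟩ := hequiv i (b i z) fun h => hz0 (Subtype.ext (by
          change z = 0
          rw [← hz', h, map_zero]))
        refine ⟨c * (a i ∘ₗ φ.toLinearMap ∘ₗ b i : Module.End A X), Subtype.ext ?_⟩
        change c (a i (φ (b i z))) = c (a i (L.q i (L.p i)))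
        rw [hφ]
    infer_instance
  have htop : ⨆ i, T i = ⊤ := by
    rw [eq_top_iff]
    intro x _
    rw [← hx x]
    refine sum_mem fun i hi => ?_
    refine (le_iSup T ⟨i, hi⟩) ?_
    by_cases h0 : b i x = 0
    · rw [h0, map_zero]
      exact zero_mem _
    · obtain ⟨φ, hφ⟩ := hequiv i _ h0
      refine Submodule.mem_span_singleton.2
        ⟨(a i ∘ₗ φ.symm.toLinearMap ∘ₗ b i : Module.End A X), ?_⟩
      change a i (φ.symm (b i (a i (L.q i (L.p i))))) = a i (b i x)
      rw [hba i hi, ← hφ, LinearEquiv.symm_apply_apply]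
  have hi : IsArtinian (Module.End A X) (⨆ i, T i : Submodule (Module.End A X) X) := isArtinian_iSup
  rw [htop] at hi
  exact isArtinian_of_linearEquiv Submodule.topEquiv

/-- This makes right ideals of the Yoneda ring stable under End(X), so chains of right ideals can be
tested over End(X). -/
theorem yonedaRing_end_smul (d : Module.End A X) (y : YonedaRing X) :
    d • y = y * yonedaOf (Ext.mk₀ (ModuleCat.ofHom d)) := by
  induction y using DirectSum.induction_on with
  | zero => rw [smul_zero, zero_mul]
  | of k α =>
    refine Eq.trans ?_ (yonedaOf_mul α (Ext.mk₀ (ModuleCat.ofHom d)) (add_zero k)).symm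
    exact ((DirectSum.lof (Module.End A X) ℕ (fun n => Ext X X n) k).map_smul d α).symm
  | add x y hx hy => rw [smul_add, add_mul, hx, hy]

/-- The Yoneda ring is right artinian if it is artinian over the endomorphism ring. -/
theorem isArtinianRing_yonedaRing_op (h : IsArtinian (Module.End A X) (YonedaRing X)) :
    IsArtinianRing (YonedaRing X)ᵐᵒᵖ := by
  let f : Submodule (YonedaRing X)ᵐᵒᵖ (YonedaRing X)ᵐᵒᵖ →
      Submodule (Module.End A X) (YonedaRing X) := fun U =>
    { carrier := {y | MulOpposite.op y ∈ U}
      add_mem' := fun hx hy => U.add_mem hx hy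
      zero_mem' := U.zero_mem
      smul_mem' := fun d y hy => by
        rw [yonedaRing_end_smul]
        exact U.smul_mem (MulOpposite.op (yonedaOf (Ext.mk₀ (ModuleCat.ofHom d)))) hy }
  have hf : StrictMono f := by
    refine Monotone.strictMono_of_injective (fun U V hUV y hy => hUV hy) fun U V hUV => ?_
    ext y
    exact SetLike.ext_iff.1 hUV (MulOpposite.unop y)
  exact hf.wellFoundedLT

theorem isArtinian_yonedaRing [IsNoetherianRing A] (hX : IsArtinian (Module.End A X) X)
    (hfin : Module.Finite A X) {N : ℕ} (hN : ∀ k, N < k → Subsingleton (Ext X X k)) :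
    IsArtinian (Module.End A X) (YonedaRing X) := by
  have := fun k => isArtinian_ext hX k X hfin
  refine isArtinian_of_injective (LinearMap.pi fun k : Fin (N + 1) =>
    DirectSum.component (Module.End A X) ℕ (fun n => Ext X X n) k) fun x y hxy => ?_
  refine DFinsupp.ext fun k => ?_
  rcases Nat.lt_or_ge N k with hk | hk
  · have := hN k hk
    exact Subsingleton.elim _ _
  · exact congrFun hxy ⟨k, Nat.lt_succ_of_le hk⟩

end ArtinianExt

theorem subsingleton_ext_of_decomposition {A : Type u} [Ring A] {X Y : ModuleCat.{u} A} {ι : Type}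
    {I : Finset ι} {S : ι → ModuleCat.{u} A} {a : ∀ i, S i →ₗ[A] X} {b : ∀ i, X →ₗ[A] S i}
    (hsum : ∑ i ∈ I, a i ∘ₗ b i = LinearMap.id) {k : ℕ}
    (h : ∀ i ∈ I, Subsingleton (Ext (S i) Y k)) : Subsingleton (Ext X Y k) := by
  have hone : ∑ i ∈ I, ModuleCat.ofHom (b i) ≫ ModuleCat.ofHom (a i) = 𝟙 X := by
    ext x
    simpa using LinearMap.congr_fun hsum x
  refine subsingleton_of_forall_eq 0 fun α => ?_
  have hs : Ext.mk₀ (∑ i ∈ I, ModuleCat.ofHom (b i) ≫ ModuleCat.ofHom (a i)) =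
      ∑ i ∈ I, Ext.mk₀ (ModuleCat.ofHom (b i) ≫ ModuleCat.ofHom (a i)) :=
    map_sum Ext.addEquiv₀.symm _ _
  rw [← Ext.mk₀_id_comp α, ← hone, hs]
  refine (map_sum (α.postcomp X (zero_add k)) _ _).trans ?_
  refine Finset.sum_eq_zero fun i hi => ?_
  have := h i hi
  change (Ext.mk₀ (ModuleCat.ofHom (b i) ≫ ModuleCat.ofHom (a i))).comp α (zero_add k) = 0
  rw [← Ext.mk₀_comp_mk₀_assoc,
    Subsingleton.elim ((Ext.mk₀ (ModuleCat.ofHom (a i))).comp α (zero_add k)) 0, Ext.comp_zero]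

/-! ### The Yoneda ring of the top of a projective module -/

theorem IsLocalFamily.exists_yoneda_idempotents {R : Type u} [Ring R] {n : ℕ} {ε : Fin n → R}
    (h : IsLocalFamily ε) {I : Finset (Fin n)} {e : R} (he : e = ∑ i ∈ I, ε i)
    (hdir : ∃ l : List (Fin n), l.Nodup ∧ l.toFinset = I ∧
      l.Pairwise fun a b => ∀ k, Subsingleton (Ext (topModule (ε a)) (topModule (ε b)) k))
    (hself : ∀ a ∈ I, ∀ k, Subsingleton (Ext (topModule (ε a)) (topModule (ε a)) (k + 1))) :
    ∃ (m : ℕ) (f : Fin m → YonedaRing (topModule e)), CompleteOrthogonalIdempotents f ∧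
      (∀ i, IsDivisionCorner (f i)) ∧ ∀ i j, i < j → ∀ y, f i * y * f j = 0 := by
  obtain ⟨a, b, hid, hort, hsum⟩ := h.exists_top_decomposition he
  obtain ⟨l, hnd, rfl, hpair⟩ := hdir
  have hmem : ∀ i : Fin l.length, l.get i ∈ l.toFinset := fun i =>
    List.mem_toFinset.2 (l.get_mem i)
  let a' : ∀ i : Fin l.length, topModule (ε (l.get i)) ⟶ topModule e := fun i =>
    ModuleCat.ofHom (a (l.get i))
  let b' : ∀ i : Fin l.length, topModule e ⟶ topModule (ε (l.get i)) := fun i =>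
    ModuleCat.ofHom (b (l.get i))
  have hid' : ∀ i, a' i ≫ b' i = 𝟙 _ := fun i =>
    congrArg ModuleCat.ofHom (hid _ (hmem i))
  have hort' : ∀ i j, i ≠ j → a' i ≫ b' j = 0 := fun i j hij =>
    congrArg ModuleCat.ofHom (hort _ (hmem i) _ (hmem j) fun hl => hij (hnd.injective_get hl))
  have hsum' : ∑ i, b' i ≫ a' i = 𝟙 (topModule e) := by
    ext x
    have hx := LinearMap.congr_fun hsum x
    rw [List.sum_toFinset _ hnd, ← Fin.sum_univ_fun_getElem, LinearMap.sum_apply] at hx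
    rw [ModuleCat.hom_sum, LinearMap.sum_apply]
    exact hx
  refine ⟨l.length, _, yoneda_completeOrthogonalIdempotents hid' hort' hsum', fun i => ?_,
    fun i j hij y => yoneda_sandwich_eq_zero (List.pairwise_iff_get.1 hpair i j hij) y⟩
  have : Simple (topModule (ε (l.get i))) :=
    (simple_iff_isSimpleModule' _).2 (h.localSystem.simple (l.get i))
  exact yoneda_isDivisionCorner hid' (hself _ (hmem i))

theorem IsLocalFamily.isArtinianRing_yonedaRing_op {R : Type u} [Ring R] [IsNoetherianRing Rᵐᵒᵖ]
    {n : ℕ} {ε : Fin n → R} (h : IsLocalFamily ε) {I : Finset (Fin n)} {e : R}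
    (he : e = ∑ i ∈ I, ε i)
    (hbound : ∃ N, ∀ a ∈ I, ∀ (Y : ModuleCat.{u} Rᵐᵒᵖ) (k : ℕ), N < k →
      Subsingleton (Ext (topModule (ε a)) Y k)) :
    IsArtinianRing (YonedaRing (topModule e))ᵐᵒᵖ := by
  obtain ⟨a, b, hid, -, hsum⟩ := h.exists_top_decomposition he
  obtain ⟨N, hN⟩ := hbound
  have : Module.Finite Rᵐᵒᵖ (rightIdeal e) := Module.Finite.span_singleton Rᵐᵒᵖ e
  exact _root_.isArtinianRing_yonedaRing_op (isArtinian_yonedaRing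
    (h.localSystem.isArtinian_end hid hsum)
    (Module.Finite.of_surjective (topMk e) (topMk_surjective e)) (N := N)
    fun k hk => subsingleton_ext_of_decomposition hsum fun i hi => hN i hi _ k hk)

theorem mainTheorem7 {R : Type u} [Ring R]
    (hsp : IsSemiperfectRing R)
    (hnoethl : IsNoetherianRing R) (hnoethr : IsNoetherianRing Rᵐᵒᵖ)
    (hbasic : IsBasicRing R)
    (e : R) (he : IsIdempotentElem e)
    (hart : IsArtinianRing (QuotientByElement (1 - e))ᵐᵒᵖ)
    (hgl : ∀ (e' : R) (he' : IsIdempotentElem e'), e' * e = e' → e * e' = e' →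
      FiniteRightGlobalDimension (IdempotentSubring he')) :
    IsDirectedRightArtinianRing (YonedaRing (topModule e)) ∧
      FiniteRightGlobalDimension (YonedaRing (topModule e)) ∧
      FiniteLeftGlobalDimension (YonedaRing (topModule e)) := by
  obtain ⟨n, ε, I, h, heI⟩ := exists_isLocalFamily hsp hbasic he
  obtain ⟨hdir, hself, hbound⟩ := h.ext_directed heI hart hgl
  obtain ⟨m, f, hf, hdiv, htri⟩ := h.exists_yoneda_idempotents heI hdir hself
  exact ⟨⟨h.isArtinianRing_yonedaRing_op heI hbound, m, f, hf,
      fun i => (hdiv i).isPrimitiveIdempotent, htri,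
      fun i => ⟨(hdiv i).nontrivial_corner _, (hdiv i).isUnit_corner _⟩⟩,
    finiteRightGlobalDimension_of_triangular hf hdiv htri,
    finiteLeftGlobalDimension_of_triangular hf hdiv htri⟩
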